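/- **Setting.** Let $\Omega\subset\mathbb R^3$ be a bounded domain with smooth boundary, $0<T<\infty$, $\overline Q=\overline\Omega\times[0,T]$, $\nu>0$. For an open set $U\subset\mathbb R^3$ let $\mathcal D_\sigma(U)$ be the space of divergence-free fields in $C_c^\infty(U)^3$, and let $H_\sigma(U)$, $V_\sigma(U)$, $W_\sigma(U)$ be its closures in $L^2(U)^3$, $H^1_0(U)^3$, $W^{1,4}_0(U)^3$. Write $(v,w)_\sigma=\int_\Omega v\cdot w\,dx$ and $\langle v,w\rangle_\sigma=\sum_{k}\int_\Omega\nabla v^{(k)}\cdot\nabla w^{(k)}dx$. The space $W_\sigma(U)$ has the norm $|v|_{1,4}=\big(\sum_{k}\int_U|\nabla v^{(k)}|^4dx\big)^{1/4}$, and $W^*_\sigma(U)$ is its dual with the dual norm. Let $g\in L^2(0,T;H_\sigma(\Omega))$ and $u_0\in W_\sigma(\Omega)$ (identified with its continuous representative). Let $p:\overline Q\to[0,\infty]$ be continuous, with $\operatorname{supp}u_0\subset\{x\in\Omega: p(x,0)>0\}$ and $|u_0|\le p(\cdot,0)$ in $\Omega$. Let $p_n:\overline Q\to(0,\infty)$,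 $n\in\mathbb N$, be Lipschitz functions such that $p_n\to p$ uniformly on $\{p\le\kappa\}$ for every $\kappa\in(0,\infty)$, and such that for every sufficiently large $M>0$ there is $n_M$ with $M\le p_n\le p$ on $\{p>M\}$ for all $n\ge n_M$. Fix $\hat\delta>0$ with $\operatorname{supp}u_0\subset\{x\in\Omega: p(x,0)\ge\hat\delta\}$, put $\hat M=\hat\delta+\max_{\overline\Omega}|u_0|$, $$\hat\delta_n=\frac1{\hat\delta}\max_{x\in\operatorname{supp}u_0}\big|\min\{p(x,0),\hat M\}-\min\{p_n(x,0),\hat M\}\big|,\qquad u_{0n}=(1-\hat\delta_n)^+u_0$$ (with $\hat\delta_n=0$ if $u_0=0$). The approximate solution $u_n$ is the solution of the following problem: $u_n\in W^{1,2}(0,T;H_\sigma(\Omega))\cap C([0,T];V_\sigma(\Omega))$, $u_n(0)=u_{0n}$, $|u_n(x,t)|\le p_n(x,t)$ for a.e. $x\in\Omega$ and all $t\in[0,T]$, and for a.e. $t\in[0,T]$ $$(u_n'(t),u_n(t)-z)_\sigma+\nu\langle u_n(t),u_n(t)-z\rangle_\sigma+\int_\Omega (u_n(t)\cdot\nabla)u_n(t)\cdot(u_n(t)-z)\,dx\le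 (g(t),u_n(t)-z)_\sigma$$ for all $z\in V_\sigma(\Omega)$ with $|z|\le p_n(\cdot,t)$ a.e. in $\Omega$. **Lemma 3.1.** Let $\kappa>0$, let $\Omega'\subset\Omega$ be open with relative closure $\tilde\Omega'=\overline{\Omega'}\cap\Omega$, let $0\le T_1\le T_1'\le T$, and assume that $p>\kappa$ on $\tilde\Omega'\times[T_1,T_1']$. Then, for all $n\ge N$, the function $u_n$ is of bounded variation as a map from $[T_1,T_1']$ into $W^*_\sigma(\Omega')$, where $u_n(t)$ acts on $W_\sigma(\Omega')$ by $z\mapsto\int_{\Omega'}u_n(t)\cdot z\,dx$. Its total variation on $[T_1,T_1']$ is at most $M_\kappa$. Here the constant $M_\kappa$ depends only on $\kappa$ and on the fixed data $\Omega,T,\nu,g,u_0$, and in particular not on $n,\Omega',T_1,T_1',p,(p_n)$. The index $N$ may depend on all of these data, on $p$, $(p_n)$, $\hat\delta$ and on $\kappa$, but not on $\Omega',T_1,T_1'$. -/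

import Mathlib

open MeasureTheory Set Filter Topology
open scoped NNReal ENNReal ContDiff

noncomputable section

namespace NSObstacle

/-- Three-dimensional Euclidean space. -/
abbrev E3 : Type := EuclideanSpace ℝ (Fin 3)

instance fact_one_le_four : Fact ((1 : ℝ≥0∞) ≤ 4) := ⟨by norm_num⟩

/-- A bounded domain (nonempty, open, connected) with smooth boundary: near each boundary point the
domain is the set where a smooth function without critical points is negative. -/
structure IsSmoothBoundedDomain (Ω : Set E3) : Prop where
  isOpen : IsOpen Ω
  isConnected : IsConnected Ω
  isBounded : Bornology.IsBounded Ω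
  smooth_boundary : ∀ x₀ ∈ frontier Ω, ∃ U : Set E3, IsOpen U ∧ x₀ ∈ U ∧
    ∃ ψ : E3 → ℝ, ContDiffOn ℝ ∞ ψ U ∧ (∀ x ∈ U, fderiv ℝ ψ x ≠ 0) ∧
      Ω ∩ U = {x ∈ U | ψ x < 0}

/-- The partial derivative `∂φ⁽ʲ⁾/∂x_k` at `x`. -/
def partialDeriv (φ : E3 → E3) (k j : Fin 3) (x : E3) : ℝ :=
  fderiv ℝ φ x (EuclideanSpace.single k 1) j

/-- The Jacobian of `φ` at `x`: its `j`-th entry is the vector `∇φ⁽ʲ⁾(x)`. The space of these matrices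
carries the `ℓ^q` norm of the Euclidean norms of the three gradients. -/
def jacobian (q : ℝ≥0∞) (φ : E3 → E3) (x : E3) : PiLp q (fun _ : Fin 3 => E3) :=
  WithLp.toLp q (fun j => WithLp.toLp 2 (fun k => partialDeriv φ k j x))

/-- `𝒟_σ(Ω)`: smooth divergence-free vector fields with compact support in `Ω`. -/
structure IsSolenoidalTest (Ω : Set E3) (φ : E3 → E3) : Prop where
  contDiff : ContDiff ℝ ∞ φ
  hasCompactSupport : HasCompactSupport φ
  tsupport_subset : tsupport φ ⊆ Ω
  div_eq_zero : ∀ x, ∑ k, partialDeriv φ k k x = 0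

lemma partialDeriv_add {φ ψ : E3 → E3} (hφ : ContDiff ℝ ∞ φ) (hψ : ContDiff ℝ ∞ ψ)
    (k j : Fin 3) (x : E3) :
    partialDeriv (φ + ψ) k j x = partialDeriv φ k j x + partialDeriv ψ k j x := by
  have h1 : DifferentiableAt ℝ φ x := hφ.differentiable (by simp) x
  have h2 : DifferentiableAt ℝ ψ x := hψ.differentiable (by simp) x
  simp [partialDeriv, fderiv_add h1 h2]

lemma partialDeriv_smul {φ : E3 → E3} (c : ℝ) (hφ : ContDiff ℝ ∞ φ) (k j : Fin 3) (x : E3) :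
    partialDeriv (c • φ) k j x = c * partialDeriv φ k j x := by
  have h1 : DifferentiableAt ℝ φ x := hφ.differentiable (by simp) x
  simp [partialDeriv, fderiv_const_smul h1]

lemma partialDeriv_zero (k j : Fin 3) (x : E3) : partialDeriv 0 k j x = 0 := by
  simp [partialDeriv]

lemma isSolenoidalTest_zero (Ω : Set E3) : IsSolenoidalTest Ω 0 where
  contDiff := contDiff_const
  hasCompactSupport := HasCompactSupport.zero
  tsupport_subset := by simp [tsupport]
  div_eq_zero := by simp [partialDeriv_zero]

lemma IsSolenoidalTest.add {Ω : Set E3} {φ ψ : E3 → E3} (hφ : IsSolenoidalTest Ω φ)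
    (hψ : IsSolenoidalTest Ω ψ) : IsSolenoidalTest Ω (φ + ψ) where
  contDiff := hφ.contDiff.add hψ.contDiff
  hasCompactSupport := hφ.hasCompactSupport.add hψ.hasCompactSupport
  tsupport_subset := (tsupport_add φ ψ).trans
    (union_subset hφ.tsupport_subset hψ.tsupport_subset)
  div_eq_zero x := by
    simp only [partialDeriv_add hφ.contDiff hψ.contDiff, Finset.sum_add_distrib,
      hφ.div_eq_zero, hψ.div_eq_zero, add_zero]

lemma IsSolenoidalTest.smul {Ω : Set E3} {φ : E3 → E3} (c : ℝ) (hφ : IsSolenoidalTest Ω φ) :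
    IsSolenoidalTest Ω (c • φ) where
  contDiff := contDiff_const.smul hφ.contDiff
  hasCompactSupport := hφ.hasCompactSupport.smul_left (f := fun _ => c)
  tsupport_subset := (closure_mono (Function.support_const_smul_subset c φ)).trans
    hφ.tsupport_subset
  div_eq_zero x := by
    simp only [partialDeriv_smul c hφ.contDiff, ← Finset.mul_sum, hφ.div_eq_zero, mul_zero]

/-- The space `𝒟_σ(Ω)`, as a subspace of `L²(Ω)³`. -/
def testL2 (Ω : Set E3) : Submodule ℝ (Lp E3 2 (volume.restrict Ω)) where
  carrier := {v | ∃ φ, IsSolenoidalTest Ω φ ∧ v =ᵐ[volume.restrict Ω] φ}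
  zero_mem' := ⟨0, isSolenoidalTest_zero Ω, Lp.coeFn_zero _ _ _⟩
  add_mem' := by
    rintro a b ⟨φ, hφ, ha⟩ ⟨ψ, hψ, hb⟩
    exact ⟨φ + ψ, hφ.add hψ, (Lp.coeFn_add a b).trans (ha.add hb)⟩
  smul_mem' := by
    rintro c a ⟨φ, hφ, ha⟩
    exact ⟨c • φ, hφ.smul c, (Lp.coeFn_smul c a).trans (ha.const_smul c)⟩

/-- `H_σ(Ω)`: the closure of `𝒟_σ(Ω)` in `L²(Ω)³`, with the inner product of `L²(Ω)³`. -/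
abbrev Hsigma (Ω : Set E3) : Submodule ℝ (Lp E3 2 (volume.restrict Ω)) :=
  (testL2 Ω).topologicalClosure

/-- The space of all pairs `(φ, ∇φ)`, `φ ∈ 𝒟_σ(Ω)`, as a subspace of `L^q(Ω)³ × L^q(Ω)^{3×3}`. -/
def testSobolev (q : ℝ≥0∞) [Fact (1 ≤ q)] (Ω : Set E3) :
    Submodule ℝ (Lp E3 q (volume.restrict Ω) ×
      Lp (PiLp q (fun _ : Fin 3 => E3)) q (volume.restrict Ω)) where
  carrier := {v | ∃ φ, IsSolenoidalTest Ω φ ∧ v.1 =ᵐ[volume.restrict Ω] φ ∧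
    v.2 =ᵐ[volume.restrict Ω] jacobian q φ}
  zero_mem' := by
    refine ⟨0, isSolenoidalTest_zero Ω, Lp.coeFn_zero _ _ _, (Lp.coeFn_zero _ _ _).trans ?_⟩
    refine Eventually.of_forall fun x => ?_
    ext j k
    simp [jacobian, partialDeriv_zero]
  add_mem' := by
    rintro a b ⟨φ, hφ, ha, ha'⟩ ⟨ψ, hψ, hb, hb'⟩
    refine ⟨φ + ψ, hφ.add hψ, (Lp.coeFn_add a.1 b.1).trans (ha.add hb),
      (Lp.coeFn_add a.2 b.2).trans ((ha'.add hb').trans ?_)⟩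
    refine Eventually.of_forall fun x => ?_
    ext j k
    simp [jacobian, partialDeriv_add hφ.contDiff hψ.contDiff]
  smul_mem' := by
    rintro c a ⟨φ, hφ, ha, ha'⟩
    refine ⟨c • φ, hφ.smul c, (Lp.coeFn_smul c a.1).trans (ha.const_smul c),
      (Lp.coeFn_smul c a.2).trans ((ha'.const_smul c).trans ?_)⟩
    refine Eventually.of_forall fun x => ?_
    ext j k
    simp [jacobian, partialDeriv_smul c hφ.contDiff]

/-- The closure of `𝒟_σ(Ω)` in `W^{1,q}_0(Ω)³`. An element is stored as the pair `(v, ∇v)` of a field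
and its weak gradient. -/
abbrev sobolevSigma (q : ℝ≥0∞) [Fact (1 ≤ q)] (Ω : Set E3) :
    Submodule ℝ (Lp E3 q (volume.restrict Ω) ×
      Lp (PiLp q (fun _ : Fin 3 => E3)) q (volume.restrict Ω)) :=
  (testSobolev q Ω).topologicalClosure

/-- `V_σ(Ω)`, with its topology as a subspace of `H¹(Ω)³`. -/
abbrev Vsigma (Ω : Set E3) := sobolevSigma 2 Ω

/-- The field of `v ∈ V_σ(Ω)`, an element of `L²(Ω)³`. -/
abbrev Vsigma.field {Ω : Set E3} (v : Vsigma Ω) : Lp E3 2 (volume.restrict Ω) := v.1.1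

/-- The weak gradient of `v ∈ V_σ(Ω)`; `Vsigma.grad v x j` is the vector `∇v⁽ʲ⁾(x)`. -/
abbrev Vsigma.grad {Ω : Set E3} (v : Vsigma Ω) :
    Lp (PiLp 2 (fun _ : Fin 3 => E3)) 2 (volume.restrict Ω) := v.1.2

/-- The embedding `V_σ(Ω) ↪ H_σ(Ω)`. -/
def Vsigma.toH {Ω : Set E3} (v : Vsigma Ω) : Hsigma Ω :=
  ⟨Vsigma.field v, by
    have h : MapsTo Prod.fst (testSobolev 2 Ω : Set (Lp E3 2 (volume.restrict Ω) ×
        Lp (PiLp 2 (fun _ : Fin 3 => E3)) 2 (volume.restrict Ω))) (testL2 Ω) := by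
      rintro a ⟨φ, hφ, ha, _⟩
      exact ⟨φ, hφ, ha⟩
    exact h.closure continuous_fst v.2⟩

/-- `W_σ(Ω)`. This is a copy of the closure of `𝒟_σ(Ω)` in `W^{1,4}_0(Ω)³`, to be normed by
`|v|_{1,4}`, the `L⁴` norm of the gradient. -/
def Wsigma (Ω : Set E3) : Type := sobolevSigma 4 Ω

instance (Ω : Set E3) : AddCommGroup (Wsigma Ω) :=
  inferInstanceAs (AddCommGroup (sobolevSigma 4 Ω))

instance (Ω : Set E3) : Module ℝ (Wsigma Ω) :=
  inferInstanceAs (Module ℝ (sobolevSigma 4 Ω))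

/-- The field of `w ∈ W_σ(Ω)`. -/
def Wsigma.field {Ω : Set E3} (w : Wsigma Ω) : Lp E3 4 (volume.restrict Ω) := w.1.1

/-- The weak gradient of `w ∈ W_σ(Ω)`. -/
def Wsigma.grad (Ω : Set E3) :
    Wsigma Ω →ₗ[ℝ] Lp (PiLp 4 (fun _ : Fin 3 => E3)) 4 (volume.restrict Ω) :=
  (LinearMap.snd ℝ (Lp E3 4 (volume.restrict Ω))
    (Lp (PiLp 4 (fun _ : Fin 3 => E3)) 4 (volume.restrict Ω))).comp (sobolevSigma 4 Ω).subtype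

/-- The norm of `W_σ(Ω)` is `|w|_{1,4} = (∑ₖ ∫ |∇w⁽ᵏ⁾|⁴)^{1/4}`. For bounded `Ω` it is definite, and
equivalent to the norm of `W^{1,4}(Ω)³`, by the Poincaré inequality. -/
instance (Ω : Set E3) : SeminormedAddCommGroup (Wsigma Ω) :=
  SeminormedAddCommGroup.induced (Wsigma Ω)
    (Lp (PiLp 4 (fun _ : Fin 3 => E3)) 4 (volume.restrict Ω)) (Wsigma.grad Ω)

instance (Ω : Set E3) : NormedSpace ℝ (Wsigma Ω) :=
  NormedSpace.induced ℝ (Wsigma Ω)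
    (Lp (PiLp 4 (fun _ : Fin 3 => E3)) 4 (volume.restrict Ω)) (Wsigma.grad Ω)

/-- `W*_σ(Ω)`, with the norm dual to `|·|_{1,4}`. -/
abbrev WsigmaDual (Ω : Set E3) : Type := StrongDual ℝ (Wsigma Ω)

/-- The continuous function `u₀`, extended by zero outside `Ω`, is an element of `W_σ(Ω)`.
(`W_σ(Ω)` embeds in `C(closure Ω)³`, and its elements vanish on the boundary.) -/
structure RepresentsWsigma (Ω : Set E3) (u₀ : E3 → E3) : Prop where
  continuous : Continuous u₀
  eq_zero : ∀ x ∉ Ω, u₀ x = 0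
  mem : ∃ w : Wsigma Ω, w.field =ᵐ[volume.restrict Ω] u₀

/-- The closed space-time cylinder `closure Ω × [0,T]`. -/
def closedCylinder (Ω : Set E3) (T : ℝ) : Set (E3 × ℝ) := closure Ω ×ˢ Icc 0 T

/-- The approximation property of positive Lipschitz obstacles `pₙ` with respect to
the obstacle `p`. -/
structure IsObstacleApproximation (Ω : Set E3) (T : ℝ) (p : E3 × ℝ → ℝ≥0∞)
    (pn : ℕ → E3 × ℝ → ℝ) : Prop where
  lipschitz : ∀ n, ∃ L : ℝ≥0, LipschitzOnWith L (pn n) (closedCylinder Ω T)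
  pos : ∀ n, ∀ y ∈ closedCylinder Ω T, 0 < pn n y
  tendsto : ∀ κ : ℝ, 0 < κ →
    TendstoUniformlyOn pn (fun y => (p y).toReal) atTop
      {y ∈ closedCylinder Ω T | p y ≤ ENNReal.ofReal κ}
  large : ∀ᶠ M : ℝ in atTop, ∃ nM : ℕ, ∀ n ≥ nM, ∀ y ∈ closedCylinder Ω T,
    ENNReal.ofReal M < p y → M ≤ pn n y ∧ ENNReal.ofReal (pn n y) ≤ p y

/-- The initial datum `u₀` is admissible for `p`: its support is contained in
`{x ∈ Ω | p(x,0) > 0}`, and `|u₀| ≤ p(·,0)` in `Ω`. -/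
structure IsAdmissibleInitial (Ω : Set E3) (p : E3 × ℝ → ℝ≥0∞) (u₀ : E3 → E3) : Prop where
  support : tsupport u₀ ⊆ {x ∈ Ω | 0 < p (x, 0)}
  le_obstacle : ∀ x ∈ Ω, ENNReal.ofReal ‖u₀ x‖ ≤ p (x, 0)

/-- `M̂ = δ + max |u₀|` over the closure of `Ω`. -/
def truncLevel (Ω : Set E3) (u₀ : E3 → E3) (δ : ℝ) : ℝ := δ + ⨆ x : closure Ω, ‖u₀ x‖

/-- `δ̂ₙ = δ⁻¹ max |p ∧ M̂ - pₙ ∧ M̂|` at time zero, over the support of `u₀`. -/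
def deltaHat (Ω : Set E3) (p : E3 × ℝ → ℝ≥0∞) (q : E3 × ℝ → ℝ) (u₀ : E3 → E3) (δ : ℝ) : ℝ :=
  1 / δ * ⨆ x : tsupport u₀,
    |(min (p (x, 0)) (ENNReal.ofReal (truncLevel Ω u₀ δ))).toReal
      - min (q (x, 0)) (truncLevel Ω u₀ δ)|

/-- The approximate initial datum `u₀ₙ = (1 - δ̂ₙ)⁺ u₀`. -/
def approxInitial (Ω : Set E3) (p : E3 × ℝ → ℝ≥0∞) (q : E3 × ℝ → ℝ) (u₀ : E3 → E3) (δ : ℝ) :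
    E3 → E3 :=
  fun x => max (1 - deltaHat Ω p q u₀ δ) 0 • u₀ x

/-- `K(q;t)`: the fields `z ∈ V_σ(Ω)` with `|z| ≤ q(·,t)` almost everywhere in `Ω`. -/
def constraintSet (Ω : Set E3) (q : E3 × ℝ → ℝ) (t : ℝ) : Set (Vsigma Ω) :=
  {z | ∀ᵐ x ∂(volume.restrict Ω), ‖Vsigma.field z x‖ ≤ q (x, t)}

/-- The convection term `∫_Ω (u·∇)u · w = ∑_{k,j} ∫_Ω u⁽ᵏ⁾ (∂u⁽ʲ⁾/∂x_k) w⁽ʲ⁾ dx`. -/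
def convection {Ω : Set E3} (u w : Vsigma Ω) : ℝ :=
  ∫ x in Ω, ∑ k, ∑ j, Vsigma.field u x k * Vsigma.grad u x j k * Vsigma.field w x j

/-- `u` solves the variational inequality `P(q; g, u₀)`, with
`u ∈ W^{1,2}(0,T;H_σ(Ω)) ∩ C([0,T];V_σ(Ω))`. Membership in `W^{1,2}(0,T;H_σ(Ω))` means that `u` is
the integral of some `u' ∈ L²(0,T;H_σ(Ω))`. -/
def IsSolution (Ω : Set E3) (T ν : ℝ) (g : ℝ → Hsigma Ω) (q : E3 × ℝ → ℝ) (u₀ : E3 → E3)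
    (u : ℝ → Vsigma Ω) : Prop :=
  ContinuousOn u (Icc 0 T) ∧
  (∀ t ∈ Icc 0 T, u t ∈ constraintSet Ω q t) ∧
  Vsigma.field (u 0) =ᵐ[volume.restrict Ω] u₀ ∧
  ∃ u' : ℝ → Hsigma Ω,
    MemLp u' 2 (volume.restrict (Ioc 0 T)) ∧
    (∀ t ∈ Icc 0 T, Vsigma.toH (u t) = Vsigma.toH (u 0) + ∫ s in (0 : ℝ)..t, u' s) ∧
    ∀ᵐ t ∂(volume.restrict (Ioc 0 T)), ∀ z ∈ constraintSet Ω q t,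
      inner ℝ (u' t) (Vsigma.toH (u t - z))
        + ν * inner ℝ (Vsigma.grad (u t)) (Vsigma.grad (u t - z))
        + convection (u t) (u t - z)
      ≤ inner ℝ (g t) (Vsigma.toH (u t - z))

end NSObstacle

end

open NSObstacle

noncomputable section

namespace NSObstacle

/-! ### Morrey's inequality for fields vanishing outside a bounded set. -/

section Morrey

/-! The variational inequality gives no control of `u'` in a dual norm, only a one-sided bound of
`-(u', z)` for admissible `z`. Where the obstacle exceeds `κ`, however, all sufficiently small
solenoidal fields are admissible, and they include the negative of each of their members. This turns
the one-sided bound into a dual norm bound.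

In detail, `pₙ ≥ β = κ/2` on `Ω' × [T₁, T₁']` for large `n` (`exists_half_le`). A test field `φ` in
`Ω'` with `|φ|_{1,4} ≤ β/C` satisfies `|φ| ≤ β` by Morrey's inequality, so its extension by zero
lies in the constraint set. Inserting it gives `-(u', φ) ≤ R(t)`, where `R = ‖g‖(‖u‖ + β) - (u', u)
+ νβ‖∇u‖ + 9β‖u‖‖∇u‖` does not depend on `φ`. The cubic term `∫ (u·∇)u·u` has dropped out since `u`
is divergence-free. Integrating over `[s, t]` and scaling, the increment `u(t) - u(s)` has dual norm
at most `(C/β) ∫ₛᵗ R`. Density of test fields carries this over to all of `W_σ(Ω')`, and summing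
over a partition bounds the variation by `(C/β) ∫ R` over `[T₁, T₁']`.

It remains to bound `∫ R` by the data. The choice `z = 0` yields `(u', u) + ν‖∇u‖² ≤ ‖g‖‖u‖`, hence
bounds for `sup ‖u‖` and `∫ ‖∇u‖²`, uniform in `n` because `|u₀ₙ| ≤ |u₀|`. The term `-(u', u)` is an
exact derivative and integrates to at most `½ sup ‖u‖²`. The constant `C` serves all `Ω' ⊆ Ω`, since
extension by zero preserves `|φ|_{1,4}`. -/

lemma lintegral_comp_segment {t : ℝ} (ht : 0 < t) (x : E3) {f : E3 → ℝ≥0∞} (hf : Measurable f) :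
    ∫⁻ y, f (x + t • (y - x)) = ENNReal.ofReal ((t ^ 3)⁻¹) * ∫⁻ y, f y := by
  have h1 : ∀ y : E3, x + t • (y - x) = t • y + (x - t • x) := fun y => by
    rw [smul_sub]; abel
  simp_rw [h1]
  have h2 : ∫⁻ y : E3, f (t • y + (x - t • x)) =
      ∫⁻ z, f (z + (x - t • x)) ∂(Measure.map (t • ·) (volume : Measure E3)) :=
    (lintegral_map (hf.comp (measurable_id.add_const _)) (measurable_const_smul t)).symm
  rw [h2, Measure.map_addHaar_smul _ ht.ne', lintegral_smul_measure,
    lintegral_add_right_eq_self f (x - t • x)]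
  have h3 : Module.finrank ℝ E3 = 3 := by simp
  rw [h3, abs_of_pos (by positivity)]
  rfl

/-- Hölder's inequality on `B` with exponents `4` and `4/3`. The dilation by `t` then costs
`(t⁻³)^{1/4}`. The power `-3/4` is integrable at `0` because the exponent `4` exceeds the dimension
`3`. -/
lemma setLIntegral_comp_segment_le {t : ℝ} (ht : 0 < t) (x : E3) {B : Set E3}
    {f : E3 → ℝ≥0∞} (hf : Measurable f) :
    ∫⁻ y in B, f (x + t • (y - x)) ≤
      ENNReal.ofReal (t ^ (-(3 / 4) : ℝ)) * (eLpNorm f 4 volume * volume B ^ (3 / 4 : ℝ)) := by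
  have hm : Measurable fun y : E3 => f (x + t • (y - x)) :=
    hf.comp (by fun_prop)
  have h1 := eLpNorm_le_eLpNorm_mul_rpow_measure_univ (μ := volume.restrict B) (p := 1) (q := 4)
    (by norm_num) hm.aestronglyMeasurable
  have h2 : eLpNorm (fun y : E3 => f (x + t • (y - x))) 4 (volume.restrict B) ≤
      ENNReal.ofReal (t ^ (-(3 / 4) : ℝ)) * eLpNorm f 4 volume := by
    refine (eLpNorm_restrict_le _ _ _ _).trans ?_
    rw [eLpNorm_eq_lintegral_rpow_enorm_toReal (by norm_num) (by norm_num),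
      eLpNorm_eq_lintegral_rpow_enorm_toReal (by norm_num) (by norm_num)]
    simp only [enorm_eq_self]
    rw [lintegral_comp_segment ht x (f := fun y => f y ^ (ENNReal.toReal 4)) (by fun_prop),
      ENNReal.mul_rpow_of_nonneg _ _ (by positivity)]
    gcongr
    rw [ENNReal.ofReal_rpow_of_nonneg (by positivity) (by positivity)]
    apply ENNReal.ofReal_le_ofReal
    rw [← Real.rpow_natCast, ← Real.rpow_neg ht.le, ← Real.rpow_mul ht.le]
    norm_num
  rw [eLpNorm_one_eq_lintegral_enorm] at h1
  simp only [enorm_eq_self] at h1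
  refine h1.trans ?_
  rw [← mul_assoc]
  have h3 : (1 / ENNReal.toReal 1 - 1 / ENNReal.toReal 4 : ℝ) = 3 / 4 := by norm_num
  rw [h3, Measure.restrict_apply_univ]
  gcongr

/-- Morrey's inequality for compactly supported functions: the `L⁴` norm of the gradient controls the
supremum. -/
lemma exists_enorm_le_eLpNorm_fderiv {Ω : Set E3} (hΩ : Bornology.IsBounded Ω) :
    ∃ C : ℝ≥0, ∀ φ : E3 → E3, ContDiff ℝ ∞ φ → tsupport φ ⊆ Ω →
      ∀ x, ‖φ x‖ₑ ≤ C * eLpNorm (fderiv ℝ φ) 4 volume := by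
  obtain ⟨R, hR, hΩR⟩ := hΩ.subset_ball_lt 0 (0 : E3)
  -- The unit ball `B` about `c` misses the ball of radius `R` containing `Ω`. Thus `φ` vanishes on
  -- `B`, and `φ x` is an average over `y ∈ B` of integrals of the derivative along the segments
  -- from `x` to `y`.
  set c : E3 := EuclideanSpace.single 0 (R + 1) with hc
  have hcn : ‖c‖ = R + 1 := by
    rw [hc, PiLp.norm_single, Real.norm_of_nonneg (by linarith)]
  set B : Set E3 := Metric.ball c 1 with hB
  have hBpos : volume B ≠ 0 := (Metric.measure_ball_pos volume c one_pos).ne'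
  have hBfin : volume B ≠ ⊤ := measure_ball_lt_top.ne
  set I : ℝ≥0∞ := ∫⁻ t in Ioc (0 : ℝ) 1, ENNReal.ofReal (t ^ (-(3 / 4) : ℝ)) with hI
  have hIfin : I ≠ ⊤ := by
    have h := (intervalIntegral.intervalIntegrable_rpow' (a := 0) (b := 1)
      (r := -(3 / 4)) (by norm_num)).1
    exact (h.lintegral_lt_top).ne
  -- Bounds `‖y - x‖`, since `‖y‖ < R + 2` on `B` and `‖x‖ < R`.
  set D : ℝ := 2 * R + 2
  set K : ℝ≥0∞ := (volume B)⁻¹ * (I * volume B ^ (3 / 4 : ℝ) * ENNReal.ofReal D) with hK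
  have hKfin : K ≠ ⊤ := by
    refine ENNReal.mul_ne_top (ENNReal.inv_ne_top.2 hBpos) (ENNReal.mul_ne_top
      (ENNReal.mul_ne_top hIfin (ENNReal.rpow_ne_top_of_nonneg (by norm_num) hBfin))
      ENNReal.ofReal_ne_top)
  refine ⟨K.toNNReal, fun φ hφ hsupp x => ?_⟩
  rw [ENNReal.coe_toNNReal hKfin]
  by_cases hx : x ∈ Ω
  swap
  · simp [image_eq_zero_of_notMem_tsupport fun h => hx (hsupp h)]
  have hxR : ‖x‖ < R := by simpa using hΩR hx
  set f : E3 → ℝ≥0∞ := fun y => ‖fderiv ℝ φ y‖ₑ with hf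
  have hcont : Continuous (fderiv ℝ φ) := hφ.continuous_fderiv (by simp)
  have hfm : Measurable f := hcont.enorm.measurable
  have hpt : ∀ y ∈ B, ‖φ x‖ₑ ≤
      ∫⁻ t in Ioc (0 : ℝ) 1, f (x + t • (y - x)) * ENNReal.ofReal D := by
    intro y hy
    have hyc : ‖y - c‖ < 1 := by
      rw [← dist_eq_norm]; exact Metric.mem_ball.1 hy
    have h1 : ‖y‖ < R + 2 := by
      calc ‖y‖ = ‖(y - c) + c‖ := by rw [sub_add_cancel]
        _ ≤ ‖y - c‖ + ‖c‖ := norm_add_le _ _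
        _ < R + 2 := by linarith
    have h2 : y ∉ Ω := fun h => by
      have hy' : ‖y‖ < R := by simpa using hΩR h
      have : ‖c‖ ≤ ‖y - c‖ + ‖y‖ := by
        calc ‖c‖ = ‖y - (y - c)‖ := by rw [sub_sub_cancel]
          _ ≤ ‖y‖ + ‖y - c‖ := norm_sub_le _ _
          _ = _ := add_comm _ _
      linarith
    have hy0 : φ y = 0 := image_eq_zero_of_notMem_tsupport fun h => h2 (hsupp h)
    have hyx : ‖y - x‖ ≤ D := (norm_sub_le _ _).trans (by simp only [D]; linarith)
    have hderiv : ∀ t ∈ uIcc (0 : ℝ) 1, HasDerivAt (fun t : ℝ => φ (x + t • (y - x)))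
        (fderiv ℝ φ (x + t • (y - x)) (y - x)) t := by
      intro t _
      have hd : DifferentiableAt ℝ φ (x + t • (y - x)) := hφ.differentiable (by simp) _
      have hl : HasDerivAt (fun t : ℝ => x + t • (y - x)) (y - x) t := by
        simpa using ((hasDerivAt_id t).smul_const (y - x)).const_add x
      exact hd.hasFDerivAt.comp_hasDerivAt t hl
    have hint : Continuous fun t : ℝ => fderiv ℝ φ (x + t • (y - x)) (y - x) :=
      (hcont.comp (by fun_prop)).clm_apply continuous_const
    have hftc := intervalIntegral.integral_eq_sub_of_hasDerivAt hderiv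
      (hint.intervalIntegrable _ _)
    simp only [one_smul, add_sub_cancel, zero_smul, add_zero, hy0, zero_sub] at hftc
    rw [← enorm_neg (φ x), ← hftc, intervalIntegral.integral_of_le zero_le_one]
    refine (enorm_integral_le_lintegral_enorm _).trans (lintegral_mono fun t => ?_)
    refine ((fderiv ℝ φ (x + t • (y - x))).le_opENorm _).trans ?_
    simp only [hf]
    gcongr
    rw [← ofReal_norm]
    exact ENNReal.ofReal_le_ofReal hyx
  have hmain : ‖φ x‖ₑ * volume B ≤
      I * volume B ^ (3 / 4 : ℝ) * ENNReal.ofReal D * eLpNorm (fderiv ℝ φ) 4 volume := by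
    calc ‖φ x‖ₑ * volume B = ∫⁻ _ in B, ‖φ x‖ₑ := by rw [setLIntegral_const]
      _ ≤ ∫⁻ y in B, ∫⁻ t in Ioc (0 : ℝ) 1, f (x + t • (y - x)) * ENNReal.ofReal D :=
        setLIntegral_mono' measurableSet_ball hpt
      _ = ∫⁻ t in Ioc (0 : ℝ) 1, ∫⁻ y in B, f (x + t • (y - x)) * ENNReal.ofReal D := by
        refine lintegral_lintegral_swap (Measurable.aemeasurable ?_)
        refine Measurable.mul_const (hfm.comp (Continuous.measurable ?_)) _
        fun_prop
      _ = ∫⁻ t in Ioc (0 : ℝ) 1, (∫⁻ y in B, f (x + t • (y - x))) * ENNReal.ofReal D := by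
        refine lintegral_congr fun t => lintegral_mul_const _ (hfm.comp (by fun_prop))
      _ ≤ ∫⁻ t in Ioc (0 : ℝ) 1, ENNReal.ofReal (t ^ (-(3 / 4) : ℝ)) *
            (eLpNorm f 4 volume * volume B ^ (3 / 4 : ℝ) * ENNReal.ofReal D) := by
        refine setLIntegral_mono' measurableSet_Ioc fun t ht => ?_
        rw [← mul_assoc]
        gcongr
        exact setLIntegral_comp_segment_le ht.1 x hfm
      _ = I * (eLpNorm f 4 volume * volume B ^ (3 / 4 : ℝ) * ENNReal.ofReal D) := by
        rw [lintegral_mul_const _ (by fun_prop)]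
      _ = _ := by rw [hf, eLpNorm_enorm]; ring
  rw [hK, mul_assoc, ← ENNReal.div_eq_inv_mul, ENNReal.le_div_iff_mul_le (Or.inl hBpos)
    (Or.inl hBfin)]
  exact hmain

end Morrey

/-! ### Absolutely continuous curves: energy identity and variation. -/

section TimeDependent

lemma absolutelyContinuousOnInterval_of_dist_le {X : Type*} [PseudoMetricSpace X] {f : ℝ → X}
    {g : ℝ → ℝ} {a b C : ℝ} (hg : AbsolutelyContinuousOnInterval g a b)
    (h : ∀ x ∈ uIcc a b, ∀ y ∈ uIcc a b, dist (f x) (f y) ≤ C * dist (g x) (g y)) :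
    AbsolutelyContinuousOnInterval f a b := by
  unfold AbsolutelyContinuousOnInterval at hg ⊢
  refine squeeze_zero' (Eventually.of_forall fun _ => Finset.sum_nonneg fun i _ => dist_nonneg) ?_
    (by simpa using hg.const_mul C)
  rw [eventually_inf_principal]
  filter_upwards with ⟨n, I⟩ hnI
  rw [Finset.mul_sum]
  exact Finset.sum_le_sum fun i hi => h _ (hnI.1 i hi).1 _ (hnI.1 i hi).2

/-- The energy identity for an absolutely continuous curve in a Hilbert space. -/
lemma integral_inner_eq_of_eq_add_integral {E : Type*} [NormedAddCommGroup E]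
    [InnerProductSpace ℝ E] [CompleteSpace E] {v v' : ℝ → E} {a b : ℝ} (hab : a ≤ b)
    (hv' : IntervalIntegrable v' volume a b)
    (hv : ∀ t ∈ Icc a b, v t = v a + ∫ s in a..t, v' s) :
    ∫ t in a..b, inner ℝ (v' t) (v t) = ‖v b‖ ^ 2 / 2 - ‖v a‖ ^ 2 / 2 := by
  set V : ℝ → E := fun t => v a + ∫ s in a..t, v' s with hV
  have hsub : ∀ x ∈ Icc a b, ∀ y ∈ Icc a b, IntervalIntegrable v' volume x y := fun x hx y hy =>
    hv'.mono_set (by rw [uIcc_of_le hab]; exact Set.uIcc_subset_Icc hx hy)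
  have hdiff : ∀ x ∈ Icc a b, ∀ y ∈ Icc a b, V y - V x = ∫ s in x..y, v' s := fun x hx y hy => by
    simp only [hV, add_sub_add_left_eq_sub]
    exact intervalIntegral.integral_interval_sub_left (hsub a (left_mem_Icc.2 hab) y hy)
      (hsub a (left_mem_Icc.2 hab) x hx)
  have hcont : ContinuousOn V (Icc a b) := by
    have := intervalIntegral.continuousOn_primitive_interval' hv' left_mem_uIcc
    rw [uIcc_of_le hab] at this
    exact continuousOn_const.add this
  obtain ⟨C, hC⟩ := isCompact_Icc.exists_bound_of_continuousOn hcont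
  set f : ℝ → ℝ := fun t => ‖V t‖ ^ 2 / 2 with hf
  have hac : AbsolutelyContinuousOnInterval f a b := by
    refine absolutelyContinuousOnInterval_of_dist_le (C := C)
      (hv'.norm.absolutelyContinuousOnInterval_intervalIntegral left_mem_uIcc) ?_
    rw [uIcc_of_le hab]
    intro x hx y hy
    -- Difference of squares: as `V` is bounded by `C`, increments of `f` are at most `C` times
    -- those of the primitive of `‖v'‖`. So `f` is absolutely continuous and the scalar fundamental
    -- theorem of calculus applies to it.
    have h1 : f y - f x = inner ℝ (V y - V x) (V y + V x) / 2 := by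
      simp only [hf]
      rw [inner_add_right, inner_sub_left, inner_sub_left, real_inner_self_eq_norm_sq,
        real_inner_self_eq_norm_sq, real_inner_comm]
      ring
    have h2 : ‖V y - V x‖ ≤ |∫ s in x..y, ‖v' s‖| := by
      rw [hdiff x hx y hy]
      exact intervalIntegral.norm_integral_le_abs_integral_norm
    have h3 : ‖V y + V x‖ ≤ C + C := (norm_add_le _ _).trans (add_le_add (hC y hy) (hC x hx))
    have hC0 : 0 ≤ C := (norm_nonneg _).trans (hC x hx)
    rw [dist_comm, dist_comm _ (∫ s in a..y, ‖v' s‖), Real.dist_eq, Real.dist_eq,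
      intervalIntegral.integral_interval_sub_left (hsub a (left_mem_Icc.2 hab) y hy).norm
      (hsub a (left_mem_Icc.2 hab) x hx).norm, h1, abs_div, abs_two]
    have h4 := abs_real_inner_le_norm (V y - V x) (V y + V x)
    have h5 : ‖V y - V x‖ * ‖V y + V x‖ ≤ |∫ s in x..y, ‖v' s‖| * (C + C) := by gcongr
    linarith
  have hderiv := hac.integral_deriv_eq_sub
  have hVb : ∀ t ∈ Icc a b, V t = v t := fun t ht => (hv t ht).symm
  simp only [hf, hVb b (right_mem_Icc.2 hab), hVb a (left_mem_Icc.2 hab)] at hderiv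
  rw [← hderiv]
  refine intervalIntegral.integral_congr_ae ?_
  filter_upwards [hv'.ae_hasDerivAt_integral] with t ht htab
  have htI : t ∈ uIcc a b := uIoc_subset_uIcc htab
  have hd : HasDerivAt V (v' t) t := (ht htI a left_mem_uIcc).const_add (v a)
  have hd2 := (hd.norm_sq).div_const 2
  rw [show (fun t => ‖V t‖ ^ 2 / 2) = fun x => ‖V x‖ ^ 2 / 2 from rfl, hd2.deriv]
  rw [uIcc_of_le hab] at htI
  rw [hVb t htI, real_inner_comm]
  ring

/-- A curve whose increments are bounded by the integral of `C` has variation at most `∫ C`. -/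
lemma eVariationOn_le_of_edist_le {E : Type*} [PseudoEMetricSpace E] {F : ℝ → E} {C : ℝ → ℝ}
    {a b : ℝ} (hC : IntervalIntegrable C volume a b) (hab : a ≤ b)
    (hC0 : ∀ s ∈ Icc a b, ∀ t ∈ Icc a b, s ≤ t → 0 ≤ ∫ r in s..t, C r)
    (h : ∀ s ∈ Icc a b, ∀ t ∈ Icc a b, s ≤ t → edist (F t) (F s) ≤
      ENNReal.ofReal (∫ r in s..t, C r)) :
    eVariationOn F (Icc a b) ≤ ENNReal.ofReal (∫ r in a..b, C r) := by
  set G : ℝ → ℝ := fun t => ∫ r in a..t, C r with hG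
  have hdiff : ∀ s ∈ Icc a b, ∀ t ∈ Icc a b, G t - G s = ∫ r in s..t, C r := fun s hs t ht =>
    intervalIntegral.integral_interval_sub_left
      (hC.mono_set (uIcc_subset_uIcc left_mem_uIcc (by rwa [uIcc_of_le hab])))
      (hC.mono_set (uIcc_subset_uIcc left_mem_uIcc (by rwa [uIcc_of_le hab])))
  -- `C` may be negative at some points; only its integrals over subintervals are known to be
  -- nonnegative, and that is all monotonicity needs.
  have hmono : MonotoneOn G (Icc a b) := fun s hs t ht hst => by
    linarith [hdiff s hs t ht, hC0 s hs t ht hst]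
  have hGvar := hmono.eVariationOn_eq (left_mem_Icc.2 hab) (right_mem_Icc.2 hab)
  rw [inter_self, hdiff a (left_mem_Icc.2 hab) b (right_mem_Icc.2 hab)] at hGvar
  rw [← hGvar]
  refine iSup_le fun ⟨n, u, hu, hus⟩ => ?_
  refine le_trans (Finset.sum_le_sum fun i _ => ?_) (eVariationOn.sum_le (f := G) hu hus (n := n))
  have hi := hu (Nat.le_succ i)
  refine (h _ (hus i) _ (hus (i + 1)) hi).trans (le_of_eq ?_)
  rw [edist_dist, Real.dist_eq, hdiff _ (hus i) _ (hus (i + 1)),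
    abs_of_nonneg (hC0 _ (hus i) _ (hus (i + 1)) hi)]

end TimeDependent

/-! ### Continuous bilinear forms on `L²` with a bounded weight, for density arguments. -/

section Pairing

variable {α : Type*} [MeasurableSpace α] {μ : Measure α}

lemma integrable_mul_mul_of_bound {b : α → ℝ} (hb : AEStronglyMeasurable b μ) {B : ℝ}
    (hB : ∀ᵐ x ∂μ, ‖b x‖ ≤ B) (f g : Lp ℝ 2 μ) : Integrable (fun x => f x * g x * b x) μ :=
  ((Lp.memLp f).integrable_mul (Lp.memLp g)).mul_bdd hb hB

lemma abs_integral_mul_mul_le {b : α → ℝ} {B : ℝ} (hB0 : 0 ≤ B)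
    (hB : ∀ᵐ x ∂μ, ‖b x‖ ≤ B) (f g : Lp ℝ 2 μ) :
    |∫ x, f x * g x * b x ∂μ| ≤ B * ‖f‖ * ‖g‖ := by
  have hfg : Integrable (fun x => ‖f x‖ * ‖g x‖) μ :=
    (Lp.memLp f).norm.integrable_mul (Lp.memLp g).norm
  have h1 : |∫ x, f x * g x * b x ∂μ| ≤ ∫ x, ‖f x‖ * ‖g x‖ * B ∂μ := by
    rw [← Real.norm_eq_abs]
    refine norm_integral_le_of_norm_le (hfg.mul_const B) ?_
    filter_upwards [hB] with x hx
    rw [norm_mul, norm_mul]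
    gcongr
  have h2 : ∫ x, ‖f x‖ * ‖g x‖ ∂μ ≤ ‖f‖ * ‖g‖ := by
    have h := integral_mul_norm_le_Lp_mul_Lq (μ := μ) (f := f) (g := g) Real.HolderConjugate.two_two
      (by simpa using Lp.memLp f) (by simpa using Lp.memLp g)
    have hn : ∀ f : Lp ℝ 2 μ, (∫ x, ‖f x‖ ^ (2 : ℝ) ∂μ) ^ (1 / 2 : ℝ) = ‖f‖ := fun f => by
      rw [Lp.norm_def, (Lp.memLp f).eLpNorm_eq_integral_rpow_norm (by norm_num) (by norm_num),
        ENNReal.toReal_ofReal (by positivity)]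
      norm_num
    rwa [hn, hn] at h
  rw [integral_mul_const] at h1
  calc _ ≤ _ := h1
    _ ≤ ‖f‖ * ‖g‖ * B := by gcongr
    _ = _ := by ring

/-- The bilinear form `(f, g) ↦ ∫ f g b` on `L²`, for a bounded weight `b`. -/
lemma exists_weighted_pairing {b : α → ℝ} (hb : AEStronglyMeasurable b μ) {B : ℝ}
    (hB : ∀ᵐ x ∂μ, ‖b x‖ ≤ B) :
    ∃ P : Lp ℝ 2 μ →L[ℝ] Lp ℝ 2 μ →L[ℝ] ℝ, ∀ f g, P f g = ∫ x, f x * g x * b x ∂μ := by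
  have hB' : ∀ᵐ x ∂μ, ‖b x‖ ≤ |B| := hB.mono fun x hx => hx.trans (le_abs_self B)
  have hint := integrable_mul_mul_of_bound hb hB
  refine ⟨LinearMap.mkContinuous₂ (LinearMap.mk₂ ℝ (fun f g : Lp ℝ 2 μ => ∫ x, f x * g x * b x ∂μ)
    ?_ ?_ ?_ ?_) |B| (fun f g => abs_integral_mul_mul_le (abs_nonneg B) hB' f g), fun f g => rfl⟩
  · intro f f' g
    rw [← integral_add (hint f g) (hint f' g)]
    refine integral_congr_ae ?_
    filter_upwards [Lp.coeFn_add f f'] with x hx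
    rw [hx, Pi.add_apply]; ring
  · intro c f g
    rw [smul_eq_mul, ← integral_const_mul]
    refine integral_congr_ae ?_
    filter_upwards [Lp.coeFn_smul c f] with x hx
    rw [hx, Pi.smul_apply, smul_eq_mul]; ring
  · intro f g g'
    rw [← integral_add (hint f g) (hint f g')]
    refine integral_congr_ae ?_
    filter_upwards [Lp.coeFn_add g g'] with x hx
    rw [hx, Pi.add_apply]; ring
  · intro c f g
    rw [smul_eq_mul, ← integral_const_mul]
    refine integral_congr_ae ?_
    filter_upwards [Lp.coeFn_smul c g] with x hx
    rw [hx, Pi.smul_apply, smul_eq_mul]; ring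

/-- The `k`-th component of a square integrable field. -/
def fieldComp (μ : Measure α) (k : Fin 3) : Lp E3 2 μ →L[ℝ] Lp ℝ 2 μ :=
  (PiLp.proj (𝕜 := ℝ) 2 (fun _ : Fin 3 => ℝ) k).compLpL 2 μ

/-- The `k`-th component of the `j`-th row of a square integrable matrix field. -/
def gradComp (μ : Measure α) (j k : Fin 3) :
    Lp (PiLp 2 (fun _ : Fin 3 => E3)) 2 μ →L[ℝ] Lp ℝ 2 μ :=
  ((PiLp.proj (𝕜 := ℝ) 2 (fun _ : Fin 3 => ℝ) k).comp
    (PiLp.proj (𝕜 := ℝ) 2 (fun _ : Fin 3 => E3) j)).compLpL 2 μ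

lemma coeFn_fieldComp (k : Fin 3) (f : Lp E3 2 μ) : fieldComp μ k f =ᵐ[μ] fun x => f x k :=
  ContinuousLinearMap.coeFn_compLpL _ f

lemma coeFn_gradComp (j k : Fin 3) (f : Lp (PiLp 2 (fun _ : Fin 3 => E3)) 2 μ) :
    gradComp μ j k f =ᵐ[μ] fun x => f x j k :=
  ContinuousLinearMap.coeFn_compLpL _ f

lemma norm_fieldComp_le (k : Fin 3) (f : Lp E3 2 μ) : ‖fieldComp μ k f‖ ≤ ‖f‖ := by
  refine Lp.norm_le_norm_of_ae_le ?_
  filter_upwards [coeFn_fieldComp k f] with x hx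
  rw [hx]; exact PiLp.norm_apply_le (f x) k

lemma norm_gradComp_le (j k : Fin 3) (f : Lp (PiLp 2 (fun _ : Fin 3 => E3)) 2 μ) :
    ‖gradComp μ j k f‖ ≤ ‖f‖ := by
  refine Lp.norm_le_norm_of_ae_le ?_
  filter_upwards [coeFn_gradComp j k f] with x hx
  rw [hx]; exact (PiLp.norm_apply_le (f x j) k).trans (PiLp.norm_apply_le (f x) j)

end Pairing

/-! ### Smooth solenoidal fields: norms of derivatives and cancellation of convection. -/

section TestFields

variable {Ω : Set E3} {φ ψ : E3 → E3}

lemma IsSolenoidalTest.mono {Ω' : Set E3} (hφ : IsSolenoidalTest Ω' φ) (h : Ω' ⊆ Ω) :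
    IsSolenoidalTest Ω φ :=
  ⟨hφ.contDiff, hφ.hasCompactSupport, hφ.tsupport_subset.trans h, hφ.div_eq_zero⟩

lemma continuous_partialDeriv (hφ : ContDiff ℝ ∞ φ) (k j : Fin 3) :
    Continuous (partialDeriv φ k j) :=
  (PiLp.continuous_apply 2 (fun _ : Fin 3 => ℝ) j).comp
    ((hφ.continuous_fderiv (by simp)).clm_apply continuous_const)

lemma continuous_jacobian (q : ℝ≥0∞) (hφ : ContDiff ℝ ∞ φ) : Continuous (jacobian q φ) :=
  (PiLp.continuous_toLp q _).comp (continuous_pi fun j =>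
    (PiLp.continuous_toLp 2 _).comp (continuous_pi fun k => continuous_partialDeriv hφ k j))

lemma partialDeriv_eq_zero {x : E3} (hx : x ∉ tsupport φ) (k j : Fin 3) :
    partialDeriv φ k j x = 0 := by
  simp [partialDeriv, fderiv_of_notMem_tsupport (𝕜 := ℝ) hx]

lemma jacobian_eq_zero (q : ℝ≥0∞) {x : E3} (hx : x ∉ tsupport φ) : jacobian q φ x = 0 := by
  ext j k
  simp [jacobian, partialDeriv_eq_zero hx]

lemma hasCompactSupport_jacobian (q : ℝ≥0∞) (hφ : HasCompactSupport φ) :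
    HasCompactSupport (jacobian q φ) :=
  HasCompactSupport.intro hφ fun _ hx => jacobian_eq_zero q hx

lemma abs_partialDeriv_le (q : ℝ≥0∞) [Fact (1 ≤ q)] (φ : E3 → E3) (k j : Fin 3) (x : E3) :
    |partialDeriv φ k j x| ≤ ‖jacobian q φ x‖ :=
  (PiLp.norm_apply_le (jacobian q φ x j) k).trans (PiLp.norm_apply_le (jacobian q φ x) j)

lemma norm_le_sum_abs (y : E3) : ‖y‖ ≤ ∑ k, |y k| := by
  have h : y = ∑ k, EuclideanSpace.single k (y k) := by
    ext i; simp [Finset.sum_apply]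
  calc ‖y‖ = ‖∑ k, EuclideanSpace.single k (y k)‖ := by rw [← h]
    _ ≤ ∑ k, ‖EuclideanSpace.single k (y k)‖ := norm_sum_le _ _
    _ = _ := by simp

/-- A crude count of entries: three columns, each with three entries bounded by the norm of the
Jacobian. -/
lemma norm_fderiv_le (φ : E3 → E3) (x : E3) : ‖fderiv ℝ φ x‖ ≤ 9 * ‖jacobian 4 φ x‖ := by
  refine ContinuousLinearMap.opNorm_le_bound _ (by positivity) fun y => ?_
  have h : y = ∑ k, y k • EuclideanSpace.single k (1 : ℝ) := by
    ext i; simp [Finset.sum_apply, Pi.single_apply]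
  have hcol : ∀ k, ‖fderiv ℝ φ x (EuclideanSpace.single k 1)‖ ≤ 3 * ‖jacobian 4 φ x‖ := fun k => by
    refine (norm_le_sum_abs _).trans ?_
    refine (Finset.sum_le_sum fun j _ => abs_partialDeriv_le 4 φ k j x).trans ?_
    simp
  calc ‖fderiv ℝ φ x y‖ = ‖∑ k, y k • fderiv ℝ φ x (EuclideanSpace.single k 1)‖ := by
        conv_lhs => rw [h, map_sum]
        simp only [map_smul]
    _ ≤ ∑ k, ‖y k • fderiv ℝ φ x (EuclideanSpace.single k 1)‖ := norm_sum_le _ _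
    _ ≤ ∑ _k : Fin 3, ‖y‖ * (3 * ‖jacobian 4 φ x‖) := Finset.sum_le_sum fun k _ => by
        rw [norm_smul]
        exact mul_le_mul (PiLp.norm_apply_le y k) (hcol k) (norm_nonneg _) (norm_nonneg _)
    _ = 9 * ‖jacobian 4 φ x‖ * ‖y‖ := by simp; ring

lemma norm_jacobian_two_le (φ : E3 → E3) (x : E3) :
    ‖jacobian 2 φ x‖ ≤ 9 * ‖jacobian 4 φ x‖ := by
  have h1 : ‖jacobian 2 φ x‖ ≤ ∑ j, ‖jacobian 2 φ x j‖ := by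
    have h : jacobian 2 φ x = ∑ j, PiLp.single 2 j (jacobian 2 φ x j) := by
      ext i k; simp [Finset.sum_apply]
    calc ‖jacobian 2 φ x‖ = ‖∑ j, PiLp.single 2 j (jacobian 2 φ x j)‖ := by rw [← h]
      _ ≤ ∑ j, ‖(PiLp.single 2 j (jacobian 2 φ x j) : PiLp 2 fun _ : Fin 3 => E3)‖ :=
        norm_sum_le _ _
      _ = _ := by simp [PiLp.norm_single]
  have h2 : ∀ j, ‖jacobian 2 φ x j‖ ≤ 3 * ‖jacobian 4 φ x‖ := fun j => by
    refine (norm_le_sum_abs _).trans ?_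
    refine (Finset.sum_le_sum fun k _ => abs_partialDeriv_le 4 φ k j x).trans ?_
    simp
  refine h1.trans ((Finset.sum_le_sum fun j _ => h2 j).trans (le_of_eq ?_))
  simp; ring

lemma IsSolenoidalTest.memLp {q : ℝ≥0∞} (hφ : IsSolenoidalTest Ω φ) (μ : Measure E3)
    [IsFiniteMeasureOnCompacts μ] : MemLp φ q μ :=
  hφ.contDiff.continuous.memLp_of_hasCompactSupport hφ.hasCompactSupport

lemma IsSolenoidalTest.memLp_jacobian (q : ℝ≥0∞) [Fact (1 ≤ q)] (hφ : IsSolenoidalTest Ω φ)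
    (μ : Measure E3) [IsFiniteMeasureOnCompacts μ] : MemLp (jacobian q φ) q μ :=
  (continuous_jacobian q hφ.contDiff).memLp_of_hasCompactSupport
    (hasCompactSupport_jacobian q hφ.hasCompactSupport)

/-- A test field as an element of `V_σ(Ω)`. -/
def IsSolenoidalTest.toV (hφ : IsSolenoidalTest Ω φ) : Vsigma Ω :=
  ⟨((hφ.memLp (volume.restrict Ω)).toLp φ,
    (hφ.memLp_jacobian 2 (volume.restrict Ω)).toLp (jacobian 2 φ)),
    Submodule.le_topologicalClosure _ ⟨φ, hφ, MemLp.coeFn_toLp (hφ.memLp (volume.restrict Ω)),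
      MemLp.coeFn_toLp (hφ.memLp_jacobian 2 (volume.restrict Ω))⟩⟩

lemma IsSolenoidalTest.coeFn_toV (hφ : IsSolenoidalTest Ω φ) :
    Vsigma.field hφ.toV =ᵐ[volume.restrict Ω] φ :=
  MemLp.coeFn_toLp (hφ.memLp (volume.restrict Ω))

lemma IsSolenoidalTest.coeFn_grad_toV (hφ : IsSolenoidalTest Ω φ) :
    Vsigma.grad hφ.toV =ᵐ[volume.restrict Ω] jacobian 2 φ :=
  MemLp.coeFn_toLp (hφ.memLp_jacobian 2 (volume.restrict Ω))

/-- The convection term vanishes on test fields, by integration by parts. -/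
lemma integral_convection_test (hφ : IsSolenoidalTest Ω φ) (hψ : IsSolenoidalTest Ω ψ) :
    ∑ k, ∑ j, ∫ x in Ω, ψ x j * partialDeriv ψ k j x * φ x k = 0 := by
  have hψd : Differentiable ℝ ψ := hψ.contDiff.differentiable (by simp)
  have hφd : Differentiable ℝ φ := hφ.contDiff.differentiable (by simp)
  have hcomp : ∀ {χ : E3 → E3} (_ : Continuous χ) (j : Fin 3), Continuous fun x => χ x j :=
    fun hχ j => (PiLp.continuous_apply 2 (fun _ : Fin 3 => ℝ) j).comp hχ
  have hφc := hcomp hφ.contDiff.continuous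
  have hψc := hcomp hψ.contDiff.continuous
  have hdφ := continuous_partialDeriv hφ.contDiff
  have hdψ := continuous_partialDeriv hψ.contDiff
  have hφ0 : ∀ x ∉ tsupport φ, φ x = 0 := fun x hx => image_eq_zero_of_notMem_tsupport hx
  have hd : ∀ (χ : E3 → E3) (_ : Differentiable ℝ χ) (j : Fin 3) (x : E3),
      HasFDerivAt (fun y => χ y j)
        ((PiLp.proj (𝕜 := ℝ) 2 (fun _ : Fin 3 => ℝ) j).comp (fderiv ℝ χ x)) x := fun χ hχ j x =>
    (PiLp.proj (𝕜 := ℝ) 2 (fun _ : Fin 3 => ℝ) j).hasFDerivAt.comp x (hχ x).hasFDerivAt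
  -- `ψⱼ ∂ₖψⱼ = ∂ₖ(ψⱼ²/2)`, so the derivative can be moved onto `φₖ`. Summation over `k` then
  -- produces the divergence of `φ`.
  have hstep : ∀ k j, ∫ x in Ω, ψ x j * partialDeriv ψ k j x * φ x k =
      -∫ x, partialDeriv φ k k x * (ψ x j ^ 2 / 2) := by
    intro k j
    have hsupp : ∫ x in Ω, ψ x j * partialDeriv ψ k j x * φ x k =
        ∫ x, φ x k * (ψ x j * partialDeriv ψ k j x) := by
      rw [setIntegral_eq_integral_of_forall_compl_eq_zero]
      · exact integral_congr_ae (Eventually.of_forall fun x => mul_comm _ _)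
      · intro x hx
        rw [hφ0 x fun h => hx (hφ.tsupport_subset h)]
        simp
    have hsq : ∀ x, HasFDerivAt (fun y => ψ y j ^ 2 / 2)
        (ψ x j • ((PiLp.proj (𝕜 := ℝ) 2 (fun _ : Fin 3 => ℝ) j).comp (fderiv ℝ ψ x))) x := by
      intro x
      have h := ((hd ψ hψd j x).pow 2).mul_const (1 / 2)
      convert! h using 1
      · ext y; ring
      · ext y; simp; ring
    have hfd : ∀ x, fderiv ℝ (fun y => ψ y j ^ 2 / 2) x (EuclideanSpace.single k 1) =
        ψ x j * partialDeriv ψ k j x := fun x => by rw [(hsq x).fderiv]; rfl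
    have hfφ : ∀ x, fderiv ℝ (fun y => φ y k) x (EuclideanSpace.single k 1) =
        partialDeriv φ k k x := fun x => by rw [(hd φ hφd k x).fderiv]; rfl
    have hibp := integral_mul_fderiv_eq_neg_fderiv_mul_of_integrable (μ := (volume : Measure E3))
      (f := fun x => φ x k) (g := fun x => ψ x j ^ 2 / 2) (v := EuclideanSpace.single k 1)
    simp only [hfd, hfφ] at hibp
    rw [hsupp]
    have hφs : ∀ x ∉ tsupport φ, φ x k = 0 := fun x hx => by rw [hφ0 x hx]; rfl
    refine hibp ?_ ?_ ?_ (fun x _ => (hd φ hφd k x).differentiableAt)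
      (fun x _ => (hsq x).differentiableAt)
    · refine Continuous.integrable_of_hasCompactSupport
        ((hdφ k k).mul (((hψc j).pow 2).div_const 2)) ?_
      exact HasCompactSupport.intro hφ.hasCompactSupport fun x hx => by
        rw [partialDeriv_eq_zero hx, zero_mul]
    · refine Continuous.integrable_of_hasCompactSupport
        ((hφc k).mul ((hψc j).mul (hdψ k j))) ?_
      exact HasCompactSupport.intro hφ.hasCompactSupport fun x hx => by rw [hφs x hx, zero_mul]
    · refine Continuous.integrable_of_hasCompactSupport
        ((hφc k).mul (((hψc j).pow 2).div_const 2)) ?_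
      exact HasCompactSupport.intro hφ.hasCompactSupport fun x hx => by rw [hφs x hx, zero_mul]
  simp only [hstep]
  rw [Finset.sum_comm]
  refine Finset.sum_eq_zero fun j _ => ?_
  rw [Finset.sum_neg_distrib, neg_eq_zero, ← integral_finsetSum]
  · simp only [← Finset.sum_mul, hφ.div_eq_zero, zero_mul, integral_zero]
  · intro k _
    refine Continuous.integrable_of_hasCompactSupport
      ((hdφ k k).mul (((hψc j).pow 2).div_const 2)) ?_
    exact HasCompactSupport.intro hφ.hasCompactSupport fun x hx => by
      rw [partialDeriv_eq_zero hx, zero_mul]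

end TestFields

/-! ### The convection term for bounded fields in `V_σ(Ω)`. -/

section Convection

variable {Ω : Set E3}

lemma aestronglyMeasurable_field_apply (w : Vsigma Ω) (j : Fin 3) :
    AEStronglyMeasurable (fun x => Vsigma.field w x j) (volume.restrict Ω) :=
  (Lp.memLp (fieldComp (volume.restrict Ω) j (Vsigma.field w))).1.congr (coeFn_fieldComp j (Vsigma.field w))

lemma ae_norm_field_apply_le {w : Vsigma Ω} {B : ℝ}
    (hw : ∀ᵐ x ∂volume.restrict Ω, ‖Vsigma.field w x‖ ≤ B) (j : Fin 3) :
    ∀ᵐ x ∂volume.restrict Ω, ‖Vsigma.field w x j‖ ≤ B :=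
  hw.mono fun x hx => (PiLp.norm_apply_le (Vsigma.field w x) j).trans hx

lemma integrable_convection_term (u : Vsigma Ω) {w : Vsigma Ω} {B : ℝ}
    (hw : ∀ᵐ x ∂volume.restrict Ω, ‖Vsigma.field w x‖ ≤ B) (k j : Fin 3) :
    Integrable (fun x => Vsigma.field u x k * Vsigma.grad u x j k * Vsigma.field w x j)
      (volume.restrict Ω) := by
  refine (integrable_mul_mul_of_bound (aestronglyMeasurable_field_apply w j)
    (ae_norm_field_apply_le hw j) (fieldComp _ k (Vsigma.field u)) (gradComp _ j k (Vsigma.grad u))).congr ?_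
  filter_upwards [coeFn_fieldComp k (Vsigma.field u), coeFn_gradComp j k (Vsigma.grad u)] with x h1 h2
  rw [h1, h2]

lemma convection_eq_sum (u : Vsigma Ω) {w : Vsigma Ω} {B : ℝ}
    (hw : ∀ᵐ x ∂volume.restrict Ω, ‖Vsigma.field w x‖ ≤ B) :
    convection u w = ∑ k, ∑ j, ∫ x in Ω, fieldComp (volume.restrict Ω) k (Vsigma.field u) x *
      gradComp (volume.restrict Ω) j k (Vsigma.grad u) x * Vsigma.field w x j := by
  rw [convection, integral_finsetSum _ fun k _ => integrable_finsetSum _ fun j _ =>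
    integrable_convection_term u hw k j]
  refine Finset.sum_congr rfl fun k _ => ?_
  rw [integral_finsetSum _ fun j _ => integrable_convection_term u hw k j]
  refine Finset.sum_congr rfl fun j _ => integral_congr_ae ?_
  filter_upwards [coeFn_fieldComp k (Vsigma.field u), coeFn_gradComp j k (Vsigma.grad u)] with x h1 h2
  rw [h1, h2]

/-- Each of the nine products is estimated by Cauchy–Schwarz with `w` as bounded weight. This is
where the factor `9` in `energyRate` comes from. -/
lemma abs_convection_le (u : Vsigma Ω) {w : Vsigma Ω} {B : ℝ} (hB : 0 ≤ B)
    (hw : ∀ᵐ x ∂volume.restrict Ω, ‖Vsigma.field w x‖ ≤ B) :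
    |convection u w| ≤ 9 * B * ‖Vsigma.field u‖ * ‖Vsigma.grad u‖ := by
  rw [convection_eq_sum u hw]
  have hterm : ∀ k j, |∫ x in Ω, fieldComp (volume.restrict Ω) k (Vsigma.field u) x *
      gradComp (volume.restrict Ω) j k (Vsigma.grad u) x * Vsigma.field w x j| ≤
      B * ‖Vsigma.field u‖ * ‖Vsigma.grad u‖ := fun k j =>
    (abs_integral_mul_mul_le hB (ae_norm_field_apply_le hw j) _ _).trans (by
      gcongr
      · exact norm_fieldComp_le _ _
      · exact norm_gradComp_le _ _ _)
  refine (Finset.abs_sum_le_sum_abs _ _).trans ((Finset.sum_le_sum fun k _ =>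
    (Finset.abs_sum_le_sum_abs _ _).trans (Finset.sum_le_sum fun j _ => hterm k j)).trans
      (le_of_eq ?_))
  simp; ring

lemma convection_sub (u : Vsigma Ω) {w z : Vsigma Ω} {B B' : ℝ}
    (hw : ∀ᵐ x ∂volume.restrict Ω, ‖Vsigma.field w x‖ ≤ B)
    (hz : ∀ᵐ x ∂volume.restrict Ω, ‖Vsigma.field z x‖ ≤ B') :
    convection u (w - z) = convection u w - convection u z := by
  rw [convection, convection, convection, ← integral_sub
    (integrable_finsetSum _ fun k _ => integrable_finsetSum _ fun j _ =>
      integrable_convection_term u hw k j)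
    (integrable_finsetSum _ fun k _ => integrable_finsetSum _ fun j _ =>
      integrable_convection_term u hz k j)]
  refine integral_congr_ae ?_
  filter_upwards [Lp.coeFn_sub (Vsigma.field w) (Vsigma.field z)] with x hx
  have hx' : Vsigma.field (w - z) x = Vsigma.field w x - Vsigma.field z x := hx
  simp only [hx', PiLp.sub_apply, mul_sub, Finset.sum_sub_distrib]

/-- The convection term `∫ (v·∇)v · v` vanishes for bounded `v ∈ V_σ(Ω)`. -/
lemma convection_self_eq_zero {v : Vsigma Ω} {B : ℝ}
    (hv : ∀ᵐ x ∂volume.restrict Ω, ‖Vsigma.field v x‖ ≤ B) : convection v v = 0 := by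
  set μ := volume.restrict Ω
  -- Density is used twice, so that one factor is always a bounded weight and the other two enter
  -- `L²`-continuously. Here the smooth transporting field is the weight, and the pair `(v, ∇v)` is
  -- approximated by test fields.
  have htest : ∀ φ : E3 → E3, IsSolenoidalTest Ω φ →
      ∑ k, ∑ j, ∫ x, fieldComp μ j (Vsigma.field v) x * gradComp μ j k (Vsigma.grad v) x * φ x k ∂μ
        = 0 := by
    intro φ hφ
    obtain ⟨C, hC⟩ := hφ.hasCompactSupport.exists_bound_of_continuous hφ.contDiff.continuous
    have hm : ∀ k, AEStronglyMeasurable (fun x => φ x k) μ := fun k =>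
      ((PiLp.continuous_apply 2 (fun _ : Fin 3 => ℝ) k).comp
        hφ.contDiff.continuous).aestronglyMeasurable
    have hb : ∀ k, ∀ᵐ x ∂μ, ‖φ x k‖ ≤ C := fun k =>
      Eventually.of_forall fun x => (PiLp.norm_apply_le (φ x) k).trans (hC x)
    choose P hP using fun k => exists_weighted_pairing (hm k) (hb k)
    simp only [← hP]
    have hclosed : IsClosed {a : Lp E3 2 μ × Lp (PiLp 2 (fun _ : Fin 3 => E3)) 2 μ |
        ∑ k, ∑ j, P k (fieldComp μ j a.1) (gradComp μ j k a.2) = 0} := by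
      refine isClosed_eq ?_ continuous_const
      fun_prop
    refine hclosed.closure_subset_iff.2 ?_ v.2
    rintro a ⟨ψ, hψ, h1, h2⟩
    rw [mem_ofPred_eq, ← integral_convection_test hφ hψ]
    refine Finset.sum_congr rfl fun k _ => Finset.sum_congr rfl fun j _ => ?_
    rw [hP]
    refine integral_congr_ae ?_
    filter_upwards [coeFn_fieldComp j a.1, coeFn_gradComp j k a.2, h1, h2] with x h3 h4 h5 h6
    rw [h3, h4, h5, h6]
    rfl
  -- Now the bounded field `v` is the weight and `∇v` is fixed; the transporting factor is
  -- approximated by test fields in `L²` alone.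
  choose P hP using fun j => exists_weighted_pairing
    (aestronglyMeasurable_field_apply v j) (ae_norm_field_apply_le hv j)
  rw [convection_eq_sum v hv]
  simp only [← hP]
  have hclosed : IsClosed {a : Lp E3 2 μ |
      ∑ k, ∑ j, P j (fieldComp μ k a) (gradComp μ j k (Vsigma.grad v)) = 0} := by
    refine isClosed_eq ?_ continuous_const
    fun_prop
  refine hclosed.closure_subset_iff.2 ?_ (Vsigma.toH v).2
  rintro a ⟨φ, hφ, ha⟩
  rw [mem_ofPred_eq, ← htest φ hφ]
  refine Finset.sum_congr rfl fun k _ => Finset.sum_congr rfl fun j _ => ?_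
  rw [hP]
  refine integral_congr_ae ?_
  filter_upwards [coeFn_fieldComp k a, coeFn_fieldComp j (Vsigma.field v), ha] with x h1 h2 h3
  rw [h1, h2, h3]
  ring

end Convection

/-! ### Embeddings of `W_σ(Ω')` uniform in `Ω'`, and `L²` fields as functionals. -/

section Duality

variable {Ω Ω' : Set E3}

lemma isFiniteMeasure_restrict_of_isBounded (hΩ : Bornology.IsBounded Ω) :
    IsFiniteMeasure ((volume : Measure E3).restrict Ω) :=
  ⟨by rw [Measure.restrict_apply_univ]; exact hΩ.measure_lt_top⟩

/-- The norm `|φ|_{1,4}` of a test field. -/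
def testNorm (Ω : Set E3) (φ : E3 → E3) : ℝ :=
  (eLpNorm (jacobian 4 φ) 4 (volume.restrict Ω)).toReal

lemma testNorm_nonneg (φ : E3 → E3) : 0 ≤ testNorm Ω φ := ENNReal.toReal_nonneg

lemma testNorm_smul {φ : E3 → E3} (c : ℝ) (hφ : ContDiff ℝ ∞ φ) :
    testNorm Ω (c • φ) = |c| * testNorm Ω φ := by
  have h : jacobian 4 (c • φ) = c • jacobian 4 φ := by
    ext x j k
    simp [jacobian, partialDeriv_smul c hφ]
  rw [testNorm, h, eLpNorm_const_smul, ENNReal.toReal_mul]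
  simp [testNorm]

/-- Invariance of the norm under extension by zero, which makes the embedding constant independent
of the subdomain. -/
lemma IsSolenoidalTest.eLpNorm_restrict {φ : E3 → E3} (hφ : IsSolenoidalTest Ω φ) :
    eLpNorm (jacobian 4 φ) 4 (volume.restrict Ω) = eLpNorm (jacobian 4 φ) 4 volume :=
  eLpNorm_restrict_eq_of_support_subset fun x hx => by
    by_contra h
    exact hx (jacobian_eq_zero 4 fun h' => h (hφ.tsupport_subset h'))

lemma IsSolenoidalTest.ofReal_testNorm {φ : E3 → E3} (hφ : IsSolenoidalTest Ω φ) :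
    ENNReal.ofReal (testNorm Ω φ) = eLpNorm (jacobian 4 φ) 4 volume := by
  rw [testNorm, ENNReal.ofReal_toReal, hφ.eLpNorm_restrict]
  exact (hφ.memLp_jacobian 4 _).2.ne

/-- The embeddings of `W_σ(Ω')` into `C(Ω)`, `L²(Ω)` and `H¹(Ω)` have a common bound for all
`Ω' ⊆ Ω`. -/
lemma exists_embedding_const (hΩ : Bornology.IsBounded Ω) :
    ∃ C : ℝ, 0 < C ∧ ∀ (Ω' : Set E3) (h : Ω' ⊆ Ω) (φ : E3 → E3) (hφ : IsSolenoidalTest Ω' φ),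
      (∀ x, ‖φ x‖ ≤ C * testNorm Ω' φ) ∧
      ‖Vsigma.field (hφ.mono h).toV‖ ≤ C * testNorm Ω' φ ∧
      ‖Vsigma.grad (hφ.mono h).toV‖ ≤ C * testNorm Ω' φ := by
  have := isFiniteMeasure_restrict_of_isBounded hΩ
  obtain ⟨K, hK⟩ := exists_enorm_le_eLpNorm_fderiv hΩ
  set c : ℝ≥0 := measureUnivNNReal (volume.restrict Ω) with hc
  -- `C₂` is the sup bound `9K` times `|Ω|^{1/2}`. `C₃` combines Hölder from `L⁴` to `L²`, with
  -- factor `|Ω|^{1/4}`, and the comparison factor `9` between the two matrix norms.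
  set C₂ : ℝ := (c : ℝ) ^ (ENNReal.toReal 2)⁻¹ * (9 * K)
  set C₃ : ℝ := 9 * (c : ℝ) ^ (1 / ENNReal.toReal 2 - 1 / ENNReal.toReal 4)
  have hK0 : (0 : ℝ) ≤ K := K.2
  have hC₂ : 0 ≤ C₂ := by positivity
  have hC₃ : 0 ≤ C₃ := by positivity
  refine ⟨9 * K + C₂ + C₃ + 1, by positivity, fun Ω' h φ hφ => ?_⟩
  have ha := testNorm_nonneg (Ω := Ω') φ
  have hsup : ∀ x, ‖φ x‖ ≤ 9 * K * testNorm Ω' φ := by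
    intro x
    have h1 := hK φ hφ.contDiff (hφ.tsupport_subset.trans h) x
    have h2 : eLpNorm (fderiv ℝ φ) 4 volume ≤ ENNReal.ofReal 9 * ENNReal.ofReal (testNorm Ω' φ) := by
      rw [hφ.ofReal_testNorm]
      exact eLpNorm_le_mul_eLpNorm_of_ae_le_mul (Eventually.of_forall fun x => norm_fderiv_le φ x) 4
    have h3 : ‖φ x‖ₑ ≤ ENNReal.ofReal (9 * K * testNorm Ω' φ) := by
      refine h1.trans ((mul_le_mul_right h2 _).trans (le_of_eq ?_))
      rw [ENNReal.ofReal_mul (by positivity), ENNReal.ofReal_mul (by norm_num),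
        ENNReal.ofReal_coe_nnreal]
      ring
    rw [← ofReal_norm] at h3
    exact (ENNReal.ofReal_le_ofReal_iff (by positivity)).1 h3
  have hle : ∀ {y b : ℝ}, y ≤ b * testNorm Ω' φ → b ≤ 9 * K + C₂ + C₃ + 1 →
      y ≤ (9 * K + C₂ + C₃ + 1) * testNorm Ω' φ := fun h h' =>
    h.trans (mul_le_mul_of_nonneg_right h' ha)
  refine ⟨fun x => hle (hsup x) (by linarith), hle (b := C₂) ?_ ?_, hle (b := C₃) ?_ ?_⟩
  · have := Lp.norm_le_of_ae_bound (f := Vsigma.field (hφ.mono h).toV) (C := 9 * K * testNorm Ω' φ)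
      (by positivity) ((hφ.mono h).coeFn_toV.mono fun x hx => by rw [hx]; exact hsup x)
    calc _ ≤ _ := this
      _ = _ := by simp only [C₂, hc]; ring
  · linarith [hK0]
  · have h1 : eLpNorm (jacobian 2 φ) 2 (volume.restrict Ω) ≤ ENNReal.ofReal (C₃ * testNorm Ω' φ) := by
      have hm := ((hφ.mono h).memLp_jacobian 2 (volume.restrict Ω)).1
      have h4 : eLpNorm (jacobian 2 φ) 4 (volume.restrict Ω) ≤
          ENNReal.ofReal 9 * ENNReal.ofReal (testNorm Ω' φ) := by
        rw [hφ.ofReal_testNorm, ← (hφ.mono h).eLpNorm_restrict]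
        exact eLpNorm_le_mul_eLpNorm_of_ae_le_mul
          (Eventually.of_forall fun x => norm_jacobian_two_le φ x) 4
      refine (eLpNorm_le_eLpNorm_mul_rpow_measure_univ (p := 2) (q := 4) (by norm_num) hm).trans
        ((mul_le_mul_left h4 _).trans (le_of_eq ?_))
      have hcu : volume.restrict Ω univ = ENNReal.ofReal c := by
        rw [hc, ENNReal.ofReal_coe_nnreal, coe_measureUnivNNReal]
      rw [hcu, ENNReal.ofReal_rpow_of_nonneg (by positivity) (by norm_num),
        ENNReal.ofReal_mul hC₃, ENNReal.ofReal_mul (by norm_num)]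
      ring
    have h2 : ‖Vsigma.grad (hφ.mono h).toV‖ = (eLpNorm (jacobian 2 φ) 2 (volume.restrict Ω)).toReal := by
      rw [Lp.norm_def, eLpNorm_congr_ae (hφ.mono h).coeFn_grad_toV]
    rw [h2]
    exact ENNReal.toReal_le_of_le_ofReal (by positivity) h1
  · linarith [hK0]

/-- The extension of `φ` by zero contributes nothing off `Ω'`. This translates the action of `v` on
fields in `Ω'` into the inner product appearing in the variational inequality. -/
lemma inner_toH_toV (hΩ : IsOpen Ω) (h : Ω' ⊆ Ω) {φ : E3 → E3}
    (hφ : IsSolenoidalTest Ω' φ) (v : Vsigma Ω) :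
    inner ℝ (Vsigma.toH v) (Vsigma.toH (hφ.mono h).toV) =
      ∫ x in Ω', inner ℝ (Vsigma.field v x) (φ x) := by
  have h1 : inner ℝ (Vsigma.toH v) (Vsigma.toH (hφ.mono h).toV) =
      ∫ x in Ω, inner ℝ (Vsigma.field v x) (Vsigma.field (hφ.mono h).toV x) := rfl
  rw [h1]
  have h2 : ∫ x in Ω, inner ℝ (Vsigma.field v x) (Vsigma.field (hφ.mono h).toV x) =
      ∫ x in Ω, inner ℝ (Vsigma.field v x) (φ x) :=
    integral_congr_ae ((hφ.mono h).coeFn_toV.mono fun x hx => by simp only [hx])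
  rw [h2]
  refine setIntegral_eq_of_subset_of_forall_sdiff_eq_zero hΩ.measurableSet h fun x hx => ?_
  rw [image_eq_zero_of_notMem_tsupport fun h' => hx.2 (hφ.tsupport_subset h'), inner_zero_right]

/-- The functional `z ↦ ∫ v · z` on `L⁴`, for `v ∈ L²`. -/
lemma exists_integral_inner_clm {μ : Measure E3} [IsFiniteMeasure μ] {v : E3 → E3}
    (hv : MemLp v 2 μ) :
    ∃ ℓ : Lp E3 4 μ →L[ℝ] ℝ, ∀ z, ℓ z = ∫ x, inner ℝ (v x) (z x) ∂μ := by
  have hz2 : ∀ z : Lp E3 4 μ, MemLp z 2 μ := fun z => (Lp.memLp z).mono_exponent (by norm_num)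
  have hval : ∀ z : Lp E3 4 μ, ∫ x, inner ℝ (v x) (z x) ∂μ =
      inner ℝ (hv.toLp v) ((hz2 z).toLp z) := fun z => by
    rw [L2.inner_def]
    refine integral_congr_ae ?_
    filter_upwards [hv.coeFn_toLp, (hz2 z).coeFn_toLp] with x h1 h2
    rw [h1, h2]
  set c : ℝ := (μ univ ^ (1 / ENNReal.toReal 2 - 1 / ENNReal.toReal 4)).toReal
  have hnorm : ∀ z : Lp E3 4 μ, ‖(hz2 z).toLp z‖ ≤ ‖z‖ * c := fun z => by
    rw [Lp.norm_toLp, Lp.norm_def, ← ENNReal.toReal_mul]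
    refine ENNReal.toReal_mono (ENNReal.mul_ne_top (Lp.memLp z).2.ne
      (ENNReal.rpow_ne_top_of_nonneg (by norm_num) (measure_ne_top _ _)))
      (eLpNorm_le_eLpNorm_mul_rpow_measure_univ (by norm_num) (Lp.memLp z).1)
  refine ⟨LinearMap.mkContinuous
    { toFun := fun z => ∫ x, inner ℝ (v x) (z x) ∂μ
      map_add' := fun z w => ?_
      map_smul' := fun a z => ?_ } (‖hv.toLp v‖ * c) fun z => ?_, fun z => rfl⟩
  · rw [hval, hval, hval, ← inner_add_right, ← MemLp.toLp_add]
    congr 1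
    exact MemLp.toLp_congr _ _ (Lp.coeFn_add z w)
  · rw [hval, hval, RingHom.id_apply, smul_eq_mul, ← real_inner_smul_right, ← MemLp.toLp_const_smul]
    congr 1
    exact MemLp.toLp_congr _ _ (Lp.coeFn_smul a z)
  · change ‖∫ x, inner ℝ (v x) (z x) ∂μ‖ ≤ _
    rw [hval]
    refine (norm_inner_le_norm _ _).trans ?_
    rw [mul_assoc, mul_comm c]
    gcongr
    exact hnorm z

/-- A bound on test fields extends to `W_σ(Ω)`. -/
lemma abs_integral_inner_le_of_test [IsFiniteMeasure ((volume : Measure E3).restrict Ω)]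
    {v : E3 → E3} (hv : MemLp v 2 (volume.restrict Ω)) {K : ℝ}
    (hK : ∀ φ, IsSolenoidalTest Ω φ → |∫ x in Ω, inner ℝ (v x) (φ x)| ≤ K * testNorm Ω φ)
    (z : Wsigma Ω) : |∫ x in Ω, inner ℝ (v x) (z.field x)| ≤ K * ‖z‖ := by
  obtain ⟨ℓ, hℓ⟩ := exists_integral_inner_clm hv
  -- The inequality is a closed condition on the pair `(z, ∇z)`, so it passes from test fields to
  -- their closure.
  have hclosed : IsClosed {a : Lp E3 4 (volume.restrict Ω) ×
      Lp (PiLp 4 (fun _ : Fin 3 => E3)) 4 (volume.restrict Ω) | |ℓ a.1| ≤ K * ‖a.2‖} :=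
    isClosed_le (by fun_prop) (by fun_prop)
  have hmem : (z.1 : Lp E3 4 (volume.restrict Ω) ×
      Lp (PiLp 4 (fun _ : Fin 3 => E3)) 4 (volume.restrict Ω)) ∈
      {a : Lp E3 4 (volume.restrict Ω) ×
      Lp (PiLp 4 (fun _ : Fin 3 => E3)) 4 (volume.restrict Ω) | |ℓ a.1| ≤ K * ‖a.2‖} := by
    refine hclosed.closure_subset_iff.2 ?_ z.2
    rintro a ⟨φ, hφ, h1, h2⟩
    have h3 : ℓ a.1 = ∫ x in Ω, inner ℝ (v x) (φ x) := by
      rw [hℓ]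
      exact integral_congr_ae (h1.mono fun x hx => by simp only [hx])
    have h4 : ‖a.2‖ = testNorm Ω φ := by
      rw [Lp.norm_def, eLpNorm_congr_ae h2, testNorm]
    rw [mem_ofPred_eq, h3, h4]
    exact hK φ hφ
  rw [mem_ofPred_eq, hℓ] at hmem
  exact hmem

/-- `v ∈ L²(Ω)` as an element of `W*_σ(Ω)`. -/
lemma exists_dual_of_test_bound [IsFiniteMeasure ((volume : Measure E3).restrict Ω)]
    {v : E3 → E3} (hv : MemLp v 2 (volume.restrict Ω)) {K : ℝ}
    (hK : ∀ φ, IsSolenoidalTest Ω φ → |∫ x in Ω, inner ℝ (v x) (φ x)| ≤ K * testNorm Ω φ) :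
    ∃ F : WsigmaDual Ω, ∀ z : Wsigma Ω, F z = ∫ x in Ω, inner ℝ (v x) (z.field x) := by
  obtain ⟨ℓ, hℓ⟩ := exists_integral_inner_clm hv
  let L : Wsigma Ω →ₗ[ℝ] ℝ := ℓ.toLinearMap.comp
    ((LinearMap.fst ℝ (Lp E3 4 (volume.restrict Ω))
      (Lp (PiLp 4 (fun _ : Fin 3 => E3)) 4 (volume.restrict Ω))).comp (sobolevSigma 4 Ω).subtype)
  have hL : ∀ z : Wsigma Ω, L z = ∫ x in Ω, inner ℝ (v x) (z.field x) := fun z => hℓ _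
  refine ⟨L.mkContinuous K fun z => ?_, hL⟩
  rw [hL]
  exact abs_integral_inner_le_of_test hv hK z

end Duality

/-! ### A priori bounds from the energy inequality. -/

section Energy

variable {E : Type*} [NormedAddCommGroup E] [InnerProductSpace ℝ E]

lemma intervalIntegrable_inner_of_continuousOn {v v' : ℝ → E} {a b : ℝ} (hab : a ≤ b)
    (hv' : IntervalIntegrable v' volume a b) (hv : ContinuousOn v (Icc a b)) :
    IntervalIntegrable (fun t => inner ℝ (v' t) (v t)) volume a b := by
  obtain ⟨S, hS⟩ := isCompact_Icc.exists_bound_of_continuousOn hv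
  rw [intervalIntegrable_iff_integrableOn_Ioc_of_le hab] at hv' ⊢
  have hvm : AEStronglyMeasurable v (volume.restrict (Ioc a b)) :=
    (hv.mono Ioc_subset_Icc_self).aestronglyMeasurable measurableSet_Ioc
  refine (hv'.norm.const_mul S).mono' (hv'.aestronglyMeasurable.inner hvm) ?_
  filter_upwards [ae_restrict_mem measurableSet_Ioc] with t ht
  refine (norm_inner_le_norm _ _).trans ?_
  rw [mul_comm]
  gcongr
  exact hS t (Ioc_subset_Icc_self ht)

/-- The dissipation bound of the energy inequality for the curve `v`, with forcing `γ`, velocity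
`v'` and gradient norm `d`: `β` bounds the test field. -/
def energyRate (ν β : ℝ) (v v' γ : ℝ → E) (d : ℝ → ℝ) (t : ℝ) : ℝ :=
  ‖γ t‖ * (‖v t‖ + β) - inner ℝ (v' t) (v t) + ν * β * d t + 9 * β * (‖v t‖ * d t)

/-- A bound for the time integral of `energyRate`. -/
def energyBound (ν β T A G : ℝ) : ℝ :=
  G * (A + 2 * G + β) + (A + 2 * G) ^ 2 / 2 +
    β * (ν + 9 * (A + 2 * G)) * ((T + (A ^ 2 / 2 + (A + 2 * G) * G) / ν) / 2)

variable {T ν : ℝ} {v v' γ : ℝ → E} {d : ℝ → ℝ}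

lemma intervalIntegrable_energyRate (hT : 0 ≤ T) (β : ℝ)
    (hv : ContinuousOn v (Icc 0 T)) (hd : ContinuousOn d (Icc 0 T))
    (hv' : IntervalIntegrable v' volume 0 T) (hγ : IntervalIntegrable γ volume 0 T) :
    IntervalIntegrable (energyRate ν β v v' γ d) volume 0 T := by
  rw [← uIcc_of_le hT] at hd
  have hvn : ContinuousOn (fun t => ‖v t‖) (uIcc 0 T) := by rw [uIcc_of_le hT]; exact hv.norm
  exact (((hγ.norm.mul_continuousOn (hvn.add continuousOn_const)).sub
    (intervalIntegrable_inner_of_continuousOn hT hv' hv)).add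
    (hd.intervalIntegrable.const_mul _)).add ((hvn.mul hd).intervalIntegrable.const_mul _)

/-- The integrated energy rate is bounded in terms of the data. -/
lemma integral_energyRate_le [CompleteSpace E] (hT : 0 ≤ T) (hν : 0 < ν) {A β : ℝ} (hβ : 0 ≤ β)
    (hv : ContinuousOn v (Icc 0 T)) (hd : ContinuousOn d (Icc 0 T)) (hd0 : ∀ t, 0 ≤ d t)
    (hv' : IntervalIntegrable v' volume 0 T) (hγ : IntervalIntegrable γ volume 0 T)
    (hvv' : ∀ t ∈ Icc 0 T, v t = v 0 + ∫ s in (0 : ℝ)..t, v' s) (hA : ‖v 0‖ ≤ A)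
    (hineq : ∀ᵐ t ∂volume.restrict (Ioc 0 T),
      inner ℝ (v' t) (v t) + ν * d t ^ 2 ≤ ‖γ t‖ * ‖v t‖) {a b : ℝ}
    (ha : 0 ≤ a) (hab : a ≤ b) (hb : b ≤ T) :
    ∫ t in a..b, energyRate ν β v v' γ d t ≤
      energyBound ν β T A (∫ t in (0 : ℝ)..T, ‖γ t‖) := by
  set G := ∫ t in (0 : ℝ)..T, ‖γ t‖ with hG
  have hA0 : 0 ≤ A := (norm_nonneg _).trans hA
  have hG0 : 0 ≤ G := intervalIntegral.integral_nonneg hT fun t _ => norm_nonneg _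
  have hsub : ∀ {f : ℝ → ℝ}, IntervalIntegrable f volume 0 T → ∀ {x y : ℝ}, 0 ≤ x → x ≤ y → y ≤ T →
      IntervalIntegrable f volume x y := fun hf x y hx hxy hy =>
    hf.mono_set (by rw [uIcc_of_le hxy, uIcc_of_le hT]; exact Icc_subset_Icc hx hy)
  have hmono : ∀ {f : ℝ → ℝ}, IntervalIntegrable f volume 0 T → (∀ t, 0 ≤ f t) →
      ∀ {x y : ℝ}, 0 ≤ x → x ≤ y → y ≤ T → ∫ t in x..y, f t ≤ ∫ t in (0 : ℝ)..T, f t :=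
    fun hf hf0 x y hx hxy hy => intervalIntegral.integral_mono_interval hx hxy hy
      (Eventually.of_forall hf0) hf
  have hin := intervalIntegrable_inner_of_continuousOn hT hv' hv
  have hdu : ContinuousOn d (uIcc 0 T) := by rwa [uIcc_of_le hT]
  have hvn : ContinuousOn (fun t => ‖v t‖) (uIcc 0 T) := by rw [uIcc_of_le hT]; exact hv.norm
  have hdi : IntervalIntegrable d volume 0 T := hdu.intervalIntegrable
  have hd2 : IntervalIntegrable (fun t => d t ^ 2) volume 0 T := (hdu.pow 2).intervalIntegrable
  have hγv := hγ.norm.mul_continuousOn hvn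
  have hen : ∀ t ∈ Icc 0 T, ∫ s in (0 : ℝ)..t, inner ℝ (v' s) (v s) =
      ‖v t‖ ^ 2 / 2 - ‖v 0‖ ^ 2 / 2 := fun t ht =>
    integral_inner_eq_of_eq_add_integral ht.1
      (hv'.mono_set (by rw [uIcc_of_le ht.1, uIcc_of_le hT]; exact Icc_subset_Icc le_rfl ht.2))
      fun s hs => hvv' s ⟨hs.1, hs.2.trans ht.2⟩
  have hA2 : ‖v 0‖ ^ 2 ≤ A ^ 2 := by gcongr
  obtain ⟨t₀, ht₀, hmax⟩ := isCompact_Icc.exists_isMaxOn ⟨0, left_mem_Icc.2 hT⟩ hv.norm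
  have hmax' : ∀ t ∈ Icc 0 T, ‖v t‖ ≤ ‖v t₀‖ := fun t ht => hmax ht
  have hgv : ∀ {m : ℝ}, (∀ t ∈ Icc 0 T, ‖v t‖ ≤ m) → 0 ≤ m → ∀ t ∈ Icc 0 T,
      ∫ s in (0 : ℝ)..t, ‖γ s‖ * ‖v s‖ ≤ G * m := fun {m} hm hm0 t ht => by
    refine (hmono hγv (fun s => by positivity) le_rfl ht.1 ht.2).trans ?_
    rw [hG, ← intervalIntegral.integral_mul_const]
    refine intervalIntegral.integral_mono_on hT hγv (hγ.norm.mul_const m) fun s hs => ?_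
    gcongr
    exact hm s hs
  have hineq' : ∀ t ∈ Icc 0 T, ‖v t‖ ^ 2 / 2 - ‖v 0‖ ^ 2 / 2 + ν * ∫ s in (0 : ℝ)..t, d s ^ 2 ≤
      ∫ s in (0 : ℝ)..t, ‖γ s‖ * ‖v s‖ := fun t ht => by
    rw [← hen t ht, ← intervalIntegral.integral_const_mul, ← intervalIntegral.integral_add
      (hsub hin le_rfl ht.1 ht.2) ((hsub hd2 le_rfl ht.1 ht.2).const_mul ν)]
    refine intervalIntegral.integral_mono_ae_restrict ht.1
      ((hsub hin le_rfl ht.1 ht.2).add ((hsub hd2 le_rfl ht.1 ht.2).const_mul ν))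
      (hsub hγv le_rfl ht.1 ht.2) ?_
    rw [← restrict_Ioc_eq_restrict_Icc]
    exact ae_restrict_of_ae_restrict_of_subset (Ioc_subset_Ioc_right ht.2) hineq
  -- At a maximum point of `‖v‖` with value `m`, the energy inequality gives `m² ≤ A² + 2Gm`. If `m
  -- > A + 2G`, then `m(m - 2G) > mA ≥ A²`, a contradiction.
  set S := A + 2 * G with hS
  have hS0 : 0 ≤ S := by positivity
  have hvS : ∀ t ∈ Icc 0 T, ‖v t‖ ≤ S := by
    have h1 := hineq' t₀ ht₀
    have h2 := hgv hmax' (norm_nonneg _) t₀ ht₀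
    have h3 : 0 ≤ ν * ∫ s in (0 : ℝ)..t₀, d s ^ 2 :=
      mul_nonneg hν.le (intervalIntegral.integral_nonneg ht₀.1 fun s _ => sq_nonneg _)
    have h4 : ‖v t₀‖ ≤ S := by
      by_contra! h
      have h5 : A < ‖v t₀‖ := by linarith
      nlinarith [mul_pos (hA0.trans_lt h5) (sub_pos.2 h), mul_nonneg hA0 (sub_pos.2 h5).le]
    exact fun t ht => (hmax' t ht).trans h4
  have hD2 : ∫ s in (0 : ℝ)..T, d s ^ 2 ≤ (A ^ 2 / 2 + S * G) / ν := by
    have h1 := hineq' T (right_mem_Icc.2 hT)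
    have h2 := hgv hvS hS0 T (right_mem_Icc.2 hT)
    rw [le_div_iff₀ hν]
    nlinarith [sq_nonneg ‖v T‖]
  have hD : ∫ s in (0 : ℝ)..T, d s ≤ (T + (A ^ 2 / 2 + S * G) / ν) / 2 := by
    -- `d ≤ (1 + d²)/2` replaces Cauchy–Schwarz in time.
    have h1 : ∫ s in (0 : ℝ)..T, d s ≤ ∫ s in (0 : ℝ)..T, (1 + d s ^ 2) / 2 :=
      intervalIntegral.integral_mono_on hT hdi
        ((intervalIntegrable_const.add hd2).div_const 2) fun s _ => by nlinarith [sq_nonneg (d s - 1)]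
    rw [intervalIntegral.integral_div, intervalIntegral.integral_add intervalIntegrable_const hd2,
      intervalIntegral.integral_const, smul_eq_mul, mul_one, sub_zero] at h1
    linarith
  have haI : a ∈ Icc 0 T := ⟨ha, hab.trans hb⟩
  have hbI : b ∈ Icc 0 T := ⟨ha.trans hab, hb⟩
  -- `(v', v)` has no pointwise bound by the data, but its integral is `(‖v b‖² - ‖v a‖²)/2`, whose
  -- positive part has the favourable sign.
  have hinab : -∫ t in a..b, inner ℝ (v' t) (v t) ≤ S ^ 2 / 2 := by
    have h1 := intervalIntegral.integral_interval_sub_left (hsub hin le_rfl hbI.1 hbI.2)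
      (hsub hin le_rfl haI.1 haI.2)
    rw [← h1, hen a haI, hen b hbI]
    have : ‖v a‖ ^ 2 ≤ S ^ 2 := by
      gcongr
      exact hvS a haI
    nlinarith [sq_nonneg ‖v b‖]
  have hgi := hsub hγ.norm ha hab hb
  have hini := hsub hin ha hab hb
  have hdi' := hsub hdi ha hab hb
  have hle : ∫ t in a..b, energyRate ν β v v' γ d t ≤
      ∫ t in a..b, (‖γ t‖ * (S + β) - inner ℝ (v' t) (v t) + β * (ν + 9 * S) * d t) := by
    refine intervalIntegral.integral_mono_on hab
      (hsub (intervalIntegrable_energyRate hT β hv hd hv' hγ) ha hab hb)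
      (((hgi.mul_const _).sub hini).add (hdi'.const_mul _)) fun t ht => ?_
    have htv := hvS t ⟨ha.trans ht.1, ht.2.trans hb⟩
    have h1 : ‖γ t‖ * (‖v t‖ + β) ≤ ‖γ t‖ * (S + β) := by gcongr
    have h2 : β * (‖v t‖ * d t) ≤ β * (S * d t) := by gcongr; exact hd0 t
    rw [energyRate]
    linarith
  refine hle.trans ?_
  rw [intervalIntegral.integral_add ((hgi.mul_const _).sub hini) (hdi'.const_mul _),
    intervalIntegral.integral_sub (hgi.mul_const _) hini, intervalIntegral.integral_mul_const,
    intervalIntegral.integral_const_mul, energyBound]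
  have h1 : (∫ t in a..b, ‖γ t‖) * (S + β) ≤ G * (S + β) := by
    gcongr
    exact hmono hγ.norm (fun t => norm_nonneg _) ha hab hb
  have h2 : β * (ν + 9 * S) * ∫ t in a..b, d t ≤
      β * (ν + 9 * S) * ((T + (A ^ 2 / 2 + S * G) / ν) / 2) := by
    gcongr
    exact (hmono hdi hd0 ha hab hb).trans hD
  linarith

end Energy

/-! ### The variational inequality at a fixed time. -/

section Pointwise

variable {Ω : Set E3}

lemma Vsigma.continuous_toH : Continuous (Vsigma.toH (Ω := Ω)) :=
  (continuous_fst.comp continuous_subtype_val).subtype_mk _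

lemma Vsigma.toH_sub (v w : Vsigma Ω) :
    Vsigma.toH (v - w) = Vsigma.toH v - Vsigma.toH w := Subtype.ext rfl

lemma Vsigma.grad_sub (v w : Vsigma Ω) :
    Vsigma.grad (v - w) = Vsigma.grad v - Vsigma.grad w := rfl

lemma Vsigma.norm_toH (v : Vsigma Ω) : ‖Vsigma.toH v‖ = ‖Vsigma.field v‖ := rfl

/-- Testing with the zero field: the convection term cancels and Cauchy–Schwarz treats the forcing.
The bound `B` is only qualitative and does not enter the result. -/
lemma energy_inequality {ν B : ℝ} {v : Vsigma Ω} {v' γ : Hsigma Ω}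
    (hv : ∀ᵐ x ∂volume.restrict Ω, ‖Vsigma.field v x‖ ≤ B)
    (h : inner ℝ v' (Vsigma.toH (v - 0)) + ν * inner ℝ (Vsigma.grad v) (Vsigma.grad (v - 0))
      + convection v (v - 0) ≤ inner ℝ γ (Vsigma.toH (v - 0))) :
    inner ℝ v' (Vsigma.toH v) + ν * ‖Vsigma.grad v‖ ^ 2 ≤ ‖γ‖ * ‖Vsigma.toH v‖ := by
  rw [sub_zero, convection_self_eq_zero hv, real_inner_self_eq_norm_sq, add_zero] at h
  exact h.trans (real_inner_le_norm _ _)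

/-- Testing with a small field `w`: everything except `(v', w)` is moved to the right, the
dissipation `ν‖∇v‖²` is discarded, and `w` enters only through its bound `β`. The right side is
therefore common to all such `w`. -/
lemma neg_inner_le_of_variational_inequality {ν β B : ℝ} (hν : 0 ≤ ν) (hβ : 0 ≤ β)
    {v w : Vsigma Ω} {v' γ : Hsigma Ω}
    (hv : ∀ᵐ x ∂volume.restrict Ω, ‖Vsigma.field v x‖ ≤ B)
    (hw : ∀ᵐ x ∂volume.restrict Ω, ‖Vsigma.field w x‖ ≤ β)
    (hwf : ‖Vsigma.field w‖ ≤ β) (hwg : ‖Vsigma.grad w‖ ≤ β)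
    (h : inner ℝ v' (Vsigma.toH (v - w)) + ν * inner ℝ (Vsigma.grad v) (Vsigma.grad (v - w))
      + convection v (v - w) ≤ inner ℝ γ (Vsigma.toH (v - w))) :
    -inner ℝ v' (Vsigma.toH w) ≤ ‖γ‖ * (‖Vsigma.toH v‖ + β) - inner ℝ v' (Vsigma.toH v)
      + ν * β * ‖Vsigma.grad v‖ + 9 * β * (‖Vsigma.toH v‖ * ‖Vsigma.grad v‖) := by
  have e1 : inner ℝ v' (Vsigma.toH (v - w)) =
      inner ℝ v' (Vsigma.toH v) - inner ℝ v' (Vsigma.toH w) := by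
    rw [Vsigma.toH_sub, inner_sub_right]
  have e2 : inner ℝ (Vsigma.grad v) (Vsigma.grad (v - w)) =
      ‖Vsigma.grad v‖ ^ 2 - inner ℝ (Vsigma.grad v) (Vsigma.grad w) := by
    rw [Vsigma.grad_sub, inner_sub_right, real_inner_self_eq_norm_sq]
  have e3 : convection v (v - w) = -convection v w := by
    rw [convection_sub v hv hw, convection_self_eq_zero hv, zero_sub]
  have h1 : inner ℝ γ (Vsigma.toH (v - w)) ≤ ‖γ‖ * (‖Vsigma.toH v‖ + β) := by
    rw [Vsigma.toH_sub]
    exact (real_inner_le_norm _ _).trans (mul_le_mul_of_nonneg_left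
      ((norm_sub_le _ _).trans (by rw [Vsigma.norm_toH w]; gcongr)) (norm_nonneg _))
  have h2 : inner ℝ (Vsigma.grad v) (Vsigma.grad w) ≤ ‖Vsigma.grad v‖ * β :=
    (real_inner_le_norm _ _).trans (mul_le_mul_of_nonneg_left hwg (norm_nonneg _))
  have h3 := (le_abs_self _).trans (abs_convection_le v hβ hw)
  rw [← Vsigma.norm_toH] at h3
  have h5 := mul_le_mul_of_nonneg_left h2 hν
  have h6 : 0 ≤ ν * ‖Vsigma.grad v‖ ^ 2 := mul_nonneg hν (sq_nonneg _)
  have h7 := h.trans h1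
  rw [e1, e2, e3] at h7
  linarith

end Pointwise

/-! ### Consequences of the obstacle approximation; admissible fields and initial data. -/

section Obstacle

variable {Ω : Set E3} {T : ℝ} {p : E3 × ℝ → ℝ≥0∞} {pn : ℕ → E3 × ℝ → ℝ}

/-- Pick an admissible level `M ≥ κ`. Above it `pₙ ≥ M` for large `n`; on `{κ < p ≤ M}` uniform
convergence loses at most `κ/2`. The index is uniform over the cylinder, hence independent of `Ω'`
and of the time interval. -/
lemma IsObstacleApproximation.exists_half_le (h : IsObstacleApproximation Ω T p pn) {κ : ℝ}
    (hκ : 0 < κ) : ∃ N : ℕ, ∀ n ≥ N, ∀ y ∈ closedCylinder Ω T,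
      ENNReal.ofReal κ < p y → κ / 2 ≤ pn n y := by
  obtain ⟨M, ⟨n₁, hn₁⟩, hM⟩ := (h.large.and (eventually_ge_atTop κ)).exists
  have hM0 : 0 < M := hκ.trans_le hM
  obtain ⟨n₂, hn₂⟩ := eventually_atTop.1
    (Metric.tendstoUniformlyOn_iff.1 (h.tendsto M hM0) (κ / 2) (half_pos hκ))
  refine ⟨max n₁ n₂, fun n hn y hy hpy => ?_⟩
  rcases lt_or_ge (ENNReal.ofReal M) (p y) with hlt | hge
  · linarith [(hn₁ n (le_of_max_le_left hn) y hy hlt).1]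
  · have h1 := hn₂ n (le_of_max_le_right hn) y ⟨hy, hge⟩
    have h2 : κ < (p y).toReal :=
      (ENNReal.ofReal_lt_iff_lt_toReal hκ.le (hge.trans_lt ENNReal.ofReal_lt_top).ne).1 hpy
    rw [Real.dist_eq] at h1
    linarith [le_abs_self ((p y).toReal - pn n y)]

/-- This bound may depend on `n`. It serves only to make the convection integrals of the solution
converge. -/
lemma IsObstacleApproximation.exists_le (h : IsObstacleApproximation Ω T p pn)
    (hΩ : Bornology.IsBounded Ω) (n : ℕ) : ∃ B, ∀ y ∈ closedCylinder Ω T, pn n y ≤ B := by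
  obtain ⟨L, hL⟩ := h.lipschitz n
  obtain ⟨B, hB⟩ := (hΩ.isCompact_closure.prod isCompact_Icc).exists_bound_of_continuousOn
    hL.continuousOn
  exact ⟨B, fun y hy => (le_abs_self _).trans (hB y hy)⟩

lemma RepresentsWsigma.memLp {u₀ : E3 → E3} (h : RepresentsWsigma Ω u₀)
    (hΩ : Bornology.IsBounded Ω) : MemLp u₀ 2 (volume.restrict Ω) :=
  h.continuous.memLp_of_hasCompactSupport (HasCompactSupport.intro hΩ.isCompact_closure
    fun x hx => h.eq_zero x fun h' => hx (subset_closure h'))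

lemma deltaHat_nonneg (Ω : Set E3) (p : E3 × ℝ → ℝ≥0∞) (q : E3 × ℝ → ℝ) (u₀ : E3 → E3) {δ : ℝ}
    (hδ : 0 < δ) : 0 ≤ deltaHat Ω p q u₀ δ :=
  -- The real supremum of an empty or unbounded family is `0`, so nonnegativity holds in every case.
  mul_nonneg (by positivity) (Real.iSup_nonneg fun _ => abs_nonneg _)

/-- Since `δ̂ₙ ≥ 0`, the factor `(1 - δ̂ₙ)⁺` lies in `[0, 1]`; this makes the energy bound uniform
in `n`. -/
lemma norm_field_le_of_eq_approxInitial {u₀ : E3 → E3} (hu₀ : MemLp u₀ 2 (volume.restrict Ω))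
    (q : E3 × ℝ → ℝ) {δ : ℝ} (hδ : 0 < δ) {v : Vsigma Ω}
    (hv : Vsigma.field v =ᵐ[volume.restrict Ω] approxInitial Ω p q u₀ δ) :
    ‖Vsigma.field v‖ ≤ (eLpNorm u₀ 2 (volume.restrict Ω)).toReal := by
  rw [Lp.norm_def]
  refine ENNReal.toReal_mono hu₀.2.ne (eLpNorm_mono_ae (hv.mono fun x hx => ?_))
  rw [hx, approxInitial, norm_smul, Real.norm_of_nonneg (le_max_right _ _)]
  refine mul_le_of_le_one_left (norm_nonneg _) (max_le ?_ zero_le_one)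
  linarith [deltaHat_nonneg Ω p q u₀ hδ]

lemma zero_mem_constraintSet {q : E3 × ℝ → ℝ} (hΩ : IsOpen Ω) {t : ℝ} (ht : t ∈ Icc 0 T)
    (hq : ∀ y ∈ closedCylinder Ω T, 0 < q y) : (0 : Vsigma Ω) ∈ constraintSet Ω q t := by
  change ∀ᵐ x ∂volume.restrict Ω, ‖Vsigma.field (0 : Vsigma Ω) x‖ ≤ q (x, t)
  filter_upwards [Lp.coeFn_zero E3 2 (volume.restrict Ω), ae_restrict_mem hΩ.measurableSet]
    with x hx hxΩ
  have h : Vsigma.field (0 : Vsigma Ω) x = 0 := hx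
  rw [h, norm_zero]
  exact (hq _ ⟨subset_closure hxΩ, ht⟩).le

/-- On `Ω'` the level `β` separates the field from the obstacle; elsewhere the field is zero and
positivity of the obstacle suffices. -/
lemma toV_mem_constraintSet {Ω' : Set E3} {q : E3 × ℝ → ℝ} (hΩ : IsOpen Ω) (h : Ω' ⊆ Ω) {t β : ℝ}
    (ht : t ∈ Icc 0 T) (hq : ∀ y ∈ closedCylinder Ω T, 0 < q y) (hβ : ∀ x ∈ Ω', β ≤ q (x, t))
    {φ : E3 → E3} (hφ : IsSolenoidalTest Ω' φ) (hφβ : ∀ x, ‖φ x‖ ≤ β) :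
    (hφ.mono h).toV ∈ constraintSet Ω q t := by
  change ∀ᵐ x ∂volume.restrict Ω, ‖Vsigma.field (hφ.mono h).toV x‖ ≤ q (x, t)
  filter_upwards [(hφ.mono h).coeFn_toV, ae_restrict_mem hΩ.measurableSet] with x hx hxΩ
  rw [hx]
  by_cases hx' : x ∈ Ω'
  · exact (hφβ x).trans (hβ x hx')
  · rw [image_eq_zero_of_notMem_tsupport fun h' => hx' (hφ.tsupport_subset h'), norm_zero]
    exact (hq _ ⟨subset_closure hxΩ, ht⟩).le

end Obstacle

/-! ### From small test fields to increments in the dual norm. -/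

section Variation

variable {Ω Ω' : Set E3}

lemma memLp_field_restrict (h : Ω' ⊆ Ω) (v : Vsigma Ω) :
    MemLp (Vsigma.field v) 2 (volume.restrict Ω') :=
  (Lp.memLp (Vsigma.field v)).mono_measure (Measure.restrict_mono h le_rfl)

lemma integral_inner_sub [IsFiniteMeasure ((volume : Measure E3).restrict Ω')] {v w : E3 → E3}
    (hv : MemLp v 2 (volume.restrict Ω')) (hw : MemLp w 2 (volume.restrict Ω')) {z : E3 → E3}
    (hz : MemLp z 2 (volume.restrict Ω')) :
    ∫ x in Ω', inner ℝ ((v - w) x) (z x) =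
      (∫ x in Ω', inner ℝ (v x) (z x)) - ∫ x in Ω', inner ℝ (w x) (z x) := by
  have hint : ∀ {v : E3 → E3}, MemLp v 2 (volume.restrict Ω') →
      Integrable (fun x => inner ℝ (v x) (z x)) (volume.restrict Ω') := fun {v} hv =>
    (hv.norm.integrable_mul hz.norm).mono (hv.1.inner hz.1) (Eventually.of_forall fun x => by
      rw [Pi.mul_apply, norm_mul, norm_norm, norm_norm]
      exact norm_inner_le_norm _ _)
  rw [← integral_sub (hint hv) (hint hw)]
  simp only [Pi.sub_apply, inner_sub_left]

/-- If the pairing of `v` with the test fields of norm at most `r` is bounded by `J`, its dual norm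
is at most `J / r`. -/
lemma abs_integral_inner_le_of_ball {v : E3 → E3} {r J : ℝ} (hr : 0 < r)
    (hJ : ∀ φ, IsSolenoidalTest Ω φ → testNorm Ω φ ≤ r → -∫ x in Ω, inner ℝ (v x) (φ x) ≤ J)
    {φ : E3 → E3} (hφ : IsSolenoidalTest Ω φ) :
    |∫ x in Ω, inner ℝ (v x) (φ x)| ≤ J / r * testNorm Ω φ := by
  set I := ∫ x in Ω, inner ℝ (v x) (φ x) with hI
  have hsmul : ∀ c : ℝ, |c| * testNorm Ω φ ≤ r → -(c * I) ≤ J := fun c hc => by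
    have h := hJ (c • φ) (hφ.smul c) (by rwa [testNorm_smul c hφ.contDiff])
    simpa only [Pi.smul_apply, real_inner_smul_right, integral_const_mul] using h
  refine le_of_forall_gt_imp_ge_of_dense fun b hb => ?_
  have hJ0 : 0 ≤ J := by simpa using hsmul 0 (by simpa using hr.le)
  have hn := testNorm_nonneg (Ω := Ω) φ
  -- Scaling by `±r/a` with `a` strictly above the norm avoids division by a possibly vanishing
  -- norm, and the two signs give the absolute value. Then `a` decreases to the norm.
  have key : ∀ a > testNorm Ω φ, |I| ≤ J / r * a := fun a ha => by
    have ha0 : 0 < a := hn.trans_lt ha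
    have hc : |r / a| * testNorm Ω φ ≤ r := by
      rw [abs_of_pos (by positivity), div_mul_eq_mul_div, div_le_iff₀ ha0]
      gcongr
    have h1 := hsmul (r / a) hc
    have h2 := hsmul (-(r / a)) (by rwa [abs_neg])
    have h3 : r / a * |I| ≤ J := by
      rcases abs_cases I with ⟨h, _⟩ | ⟨h, _⟩ <;> rw [h] <;> linarith
    rw [div_mul_eq_mul_div, le_div_iff₀ hr]
    rw [div_mul_eq_mul_div, div_le_iff₀ ha0] at h3
    linarith
  have hlim : Tendsto (fun a => J / r * a) (𝓝[>] testNorm Ω φ) (𝓝 (J / r * testNorm Ω φ)) :=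
    ((continuous_const.mul continuous_id).tendsto _).mono_left nhdsWithin_le_nhds
  exact (ge_of_tendsto hlim (eventually_nhdsWithin_of_forall key)).trans hb.le

set_option maxHeartbeats 1000000 in
/-- The variational inequality bounds the increments of a solution, tested with small fields
supported where the obstacle is at least `β`. -/
lemma neg_integral_inner_increment_le {T ν β B T₁ T₁' : ℝ} {q : E3 × ℝ → ℝ} {g u' : ℝ → Hsigma Ω}
    {u : ℝ → Vsigma Ω} (hΩ : IsOpen Ω) (hΩ' : Ω' ⊆ Ω) (hν : 0 ≤ ν) (hβ : 0 ≤ β) (hT : 0 ≤ T)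
    (hT₁ : 0 ≤ T₁) (hT₁' : T₁' ≤ T) (hucont : ContinuousOn u (Icc 0 T))
    (hu'i : IntervalIntegrable u' volume 0 T) (hgi : IntervalIntegrable g volume 0 T)
    (huint : ∀ t ∈ Icc 0 T, Vsigma.toH (u t) = Vsigma.toH (u 0) + ∫ s in (0 : ℝ)..t, u' s)
    (hbdd : ∀ t ∈ Icc 0 T, ∀ᵐ x ∂volume.restrict Ω, ‖Vsigma.field (u t) x‖ ≤ B)
    (huineq : ∀ᵐ t ∂(volume.restrict (Ioc 0 T)), ∀ z ∈ constraintSet Ω q t,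
      inner ℝ (u' t) (Vsigma.toH (u t - z))
        + ν * inner ℝ (Vsigma.grad (u t)) (Vsigma.grad (u t - z))
        + convection (u t) (u t - z)
      ≤ inner ℝ (g t) (Vsigma.toH (u t - z)))
    (hq0 : ∀ y ∈ closedCylinder Ω T, 0 < q y)
    (hq : ∀ x ∈ Ω', ∀ t ∈ Icc T₁ T₁', β ≤ q (x, t)) {s t : ℝ} (hs : s ∈ Icc T₁ T₁')
    (ht : t ∈ Icc T₁ T₁') (hst : s ≤ t) {φ : E3 → E3} (hφ : IsSolenoidalTest Ω' φ)
    (hφs : ∀ x, ‖φ x‖ ≤ β) (hφf : ‖Vsigma.field (hφ.mono hΩ').toV‖ ≤ β)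
    (hφg : ‖Vsigma.grad (hφ.mono hΩ').toV‖ ≤ β)
    [IsFiniteMeasure ((volume : Measure E3).restrict Ω')] :
    -∫ x in Ω', inner ℝ ((Vsigma.field (u t) - Vsigma.field (u s) : E3 → E3) x) (φ x) ≤
      ∫ τ in s..t, energyRate ν β (fun t => Vsigma.toH (u t)) u' g
        (fun t => ‖Vsigma.grad (u t)‖) τ := by
  have hsubI : Icc T₁ T₁' ⊆ Icc 0 T := Icc_subset_Icc hT₁ hT₁'
  have hRi : IntervalIntegrable (energyRate ν β (fun t => Vsigma.toH (u t)) u' g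
      fun t => ‖Vsigma.grad (u t)‖) volume 0 T :=
    intervalIntegrable_energyRate hT β (Vsigma.continuous_toH.comp_continuousOn hucont)
      ((continuous_snd.comp continuous_subtype_val).norm.comp_continuousOn hucont) hu'i hgi
  have hu'0 : ∀ x ∈ Icc 0 T, IntervalIntegrable u' volume 0 x := fun x hx =>
    hu'i.mono_set (uIcc_subset_uIcc left_mem_uIcc (by rwa [uIcc_of_le hT]))
  have hu'st : IntervalIntegrable u' volume s t :=
    (hu'0 s (hsubI hs)).symm.trans (hu'0 t (hsubI ht))
  have hRst : IntervalIntegrable (energyRate ν β (fun t => Vsigma.toH (u t)) u' g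
      fun t => ‖Vsigma.grad (u t)‖) volume s t :=
    hRi.mono_set (uIcc_subset_uIcc (by rw [uIcc_of_le hT]; exact hsubI hs)
      (by rw [uIcc_of_le hT]; exact hsubI ht))
  set Φ := (hφ.mono hΩ').toV
  have hdiff : Vsigma.toH (u t) - Vsigma.toH (u s) = ∫ τ in s..t, u' τ := by
    rw [huint t (hsubI ht), huint s (hsubI hs), add_sub_add_left_eq_sub]
    exact intervalIntegral.integral_interval_sub_left (hu'0 t (hsubI ht)) (hu'0 s (hsubI hs))
  -- The time integral of `u'` commutes with the continuous functional given by the fixed field `Φ`.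
  have hpair : ∫ x in Ω', inner ℝ ((Vsigma.field (u t) - Vsigma.field (u s) : E3 → E3) x) (φ x) =
      ∫ τ in s..t, inner ℝ (u' τ) (Vsigma.toH Φ) := by
    rw [integral_inner_sub (memLp_field_restrict hΩ' _) (memLp_field_restrict hΩ' _) (hφ.memLp _),
      ← inner_toH_toV hΩ hΩ' hφ, ← inner_toH_toV hΩ hΩ' hφ, ← inner_sub_left,
      hdiff, real_inner_comm]
    have := (innerSL ℝ (Vsigma.toH Φ)).intervalIntegral_comp_comm hu'st
    simp only [innerSL_apply_apply] at this
    rw [← this]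
    exact intervalIntegral.integral_congr fun τ _ => real_inner_comm _ _
  have hinn : IntervalIntegrable (fun τ => inner ℝ (u' τ) (Vsigma.toH Φ)) volume s t :=
    intervalIntegrable_inner_of_continuousOn hst hu'st continuousOn_const
  rw [hpair, ← intervalIntegral.integral_neg]
  refine intervalIntegral.integral_mono_ae_restrict hst hinn.neg hRst ?_
  have hsub : Ioc s t ⊆ Ioc 0 T := Ioc_subset_Ioc (hsubI hs).1 (hsubI ht).2
  rw [← restrict_Ioc_eq_restrict_Icc]
  filter_upwards [ae_restrict_of_ae_restrict_of_subset hsub huineq,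
    ae_restrict_mem measurableSet_Ioc] with τ hτ hτI
  have hτ0 : τ ∈ Icc 0 T := Ioc_subset_Icc_self (hsub hτI)
  have hτ1 : τ ∈ Icc T₁ T₁' := ⟨hs.1.trans hτI.1.le, hτI.2.trans ht.2⟩
  refine neg_inner_le_of_variational_inequality hν hβ (hbdd τ hτ0) ?_
    hφf hφg (hτ Φ ?_)
  · exact (hφ.mono hΩ').coeFn_toV.mono fun x hx => by rw [hx]; exact hφs x
  · exact toV_mem_constraintSet hΩ hΩ' hτ0 hq0
      (fun x hx => hq x hx τ hτ1) hφ hφs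

end Variation

end NSObstacle

end


/-! ### The variation bound. -/

open NSObstacle
set_option maxHeartbeats 1000000 in
theorem lemma3p1 (Ω : Set E3) (hΩ : IsSmoothBoundedDomain Ω) (T : ℝ) (hT : 0 < T)
    (ν : ℝ) (hν : 0 < ν) (g : ℝ → Hsigma Ω) (hg : MemLp g 2 (volume.restrict (Ioc 0 T)))
    (u₀ : E3 → E3) (hu₀ : RepresentsWsigma Ω u₀) :
    ∃ M : ℝ → ℝ≥0,
      ∀ (p : E3 × ℝ → ℝ≥0∞), ContinuousOn p (closedCylinder Ω T) →
      IsAdmissibleInitial Ω p u₀ →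
      ∀ (pn : ℕ → E3 × ℝ → ℝ), IsObstacleApproximation Ω T p pn →
      ∀ (δ : ℝ), 0 < δ → (∀ x ∈ tsupport u₀, ENNReal.ofReal δ ≤ p (x, 0)) →
      ∀ (κ : ℝ), 0 < κ → ∃ N : ℕ,
      ∀ (Ω' : Set E3), IsOpen Ω' → Ω' ⊆ Ω →
      ∀ (T₁ T₁' : ℝ), 0 ≤ T₁ → T₁ ≤ T₁' → T₁' ≤ T →
      (∀ x ∈ closure Ω' ∩ Ω, ∀ t ∈ Icc T₁ T₁', ENNReal.ofReal κ < p (x, t)) →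
      ∀ n ≥ N, ∀ (u : ℝ → Vsigma Ω),
        IsSolution Ω T ν g (pn n) (approxInitial Ω p (pn n) u₀ δ) u →
        ∃ F : ℝ → WsigmaDual Ω',
          (∀ t ∈ Icc T₁ T₁', ∀ z : Wsigma Ω',
            F t z = ∫ x in Ω', inner ℝ (Vsigma.field (u t) x) (z.field x)) ∧
          BoundedVariationOn F (Icc T₁ T₁') ∧
          eVariationOn F (Icc T₁ T₁') ≤ M κ := by
  have := isFiniteMeasure_restrict_of_isBounded hΩ.isBounded
  obtain ⟨C, hC, hemb⟩ := exists_embedding_const hΩ.isBounded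
  have hgi : IntervalIntegrable g volume 0 T :=
    (intervalIntegrable_iff_integrableOn_Ioc_of_le hT.le).2 (hg.integrable (by norm_num))
  have hu₀L := hu₀.memLp hΩ.isBounded
  set A : ℝ := (eLpNorm u₀ 2 (volume.restrict Ω)).toReal
  -- Here `κ / 2` is the size `β` of admissible fields, and `κ / 2 / C` is the radius of a ball of
  -- test fields in `|·|_{1,4}` on which the sup, `L²` and gradient norms are all at most `β`.
  refine ⟨fun κ => Real.toNNReal
    (energyBound ν (κ / 2) T A (∫ t in (0 : ℝ)..T, ‖g t‖) / (κ / 2 / C)), ?_⟩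
  intro p _ _ pn hpn δ hδ _ κ hκ
  obtain ⟨N, hN⟩ := hpn.exists_half_le hκ
  refine ⟨N, fun Ω' _ hΩ' T₁ T₁' hT₁ hT₁₁' hT₁' hpκ n hn u hu => ?_⟩
  obtain ⟨hucont, hucons, hu0, u', hu', huint, huineq⟩ := hu
  have : IsFiniteMeasure ((volume : Measure E3).restrict Ω') :=
    isFiniteMeasure_restrict_of_isBounded (hΩ.isBounded.subset hΩ')
  obtain ⟨B, hB⟩ := hpn.exists_le hΩ.isBounded n
  have hbdd : ∀ t ∈ Icc 0 T, ∀ᵐ x ∂volume.restrict Ω, ‖Vsigma.field (u t) x‖ ≤ B := by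
    intro t ht
    filter_upwards [hucons t ht, ae_restrict_mem hΩ.isOpen.measurableSet] with x hx hxΩ
    exact hx.trans (hB _ ⟨subset_closure hxΩ, ht⟩)
  set v : ℝ → Hsigma Ω := fun t => Vsigma.toH (u t) with hv
  set d : ℝ → ℝ := fun t => ‖Vsigma.grad (u t)‖ with hd
  have hvcont : ContinuousOn v (Icc 0 T) := Vsigma.continuous_toH.comp_continuousOn hucont
  have hdcont : ContinuousOn d (Icc 0 T) :=
    (continuous_snd.comp continuous_subtype_val).norm.comp_continuousOn hucont
  have hd0 : ∀ t, 0 ≤ d t := fun t => norm_nonneg _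
  have hu'i : IntervalIntegrable u' volume 0 T :=
    (intervalIntegrable_iff_integrableOn_Ioc_of_le hT.le).2 (hu'.integrable (by norm_num))
  set β := κ / 2 with hβ
  have hβ0 : 0 < β := half_pos hκ
  have henergy : ∀ᵐ t ∂volume.restrict (Ioc 0 T),
      inner ℝ (u' t) (v t) + ν * d t ^ 2 ≤ ‖g t‖ * ‖v t‖ := by
    filter_upwards [huineq, ae_restrict_mem measurableSet_Ioc] with t ht htI
    have htI' := Ioc_subset_Icc_self htI
    exact energy_inequality (hbdd t htI')
      (ht 0 (zero_mem_constraintSet hΩ.isOpen htI' (hpn.pos n)))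
  set R : ℝ → ℝ := energyRate ν β v u' g d with hR
  have hRi : IntervalIntegrable R volume 0 T :=
    intervalIntegrable_energyRate hT.le β hvcont hdcont hu'i hgi
  have hRbound : ∫ t in T₁..T₁', R t ≤ energyBound ν β T A (∫ t in (0 : ℝ)..T, ‖g t‖) :=
    integral_energyRate_le hT.le hν hβ0.le hvcont hdcont hd0 hu'i hgi huint
      (norm_field_le_of_eq_approxInitial hu₀L (pn n) hδ hu0) henergy hT₁ hT₁₁' hT₁'
  have hr : 0 < β / C := div_pos hβ0 hC
  have hsubI : Icc T₁ T₁' ⊆ Icc 0 T := Icc_subset_Icc hT₁ hT₁'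
  have hemb' : ∀ φ (hφ : IsSolenoidalTest Ω' φ), testNorm Ω' φ ≤ β / C →
      (∀ x, ‖φ x‖ ≤ β) ∧ ‖Vsigma.field (hφ.mono hΩ').toV‖ ≤ β ∧
        ‖Vsigma.grad (hφ.mono hΩ').toV‖ ≤ β := fun φ hφ hφr => by
    have hCr : C * testNorm Ω' φ ≤ β := by
      rw [mul_comm]; exact (le_div_iff₀ hC).1 hφr
    obtain ⟨h1, h2, h3⟩ := hemb Ω' hΩ' φ hφ
    exact ⟨fun x => (h1 x).trans hCr, h2.trans hCr, h3.trans hCr⟩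
  have hvar : ∀ s ∈ Icc T₁ T₁', ∀ t ∈ Icc T₁ T₁', s ≤ t → ∀ φ, IsSolenoidalTest Ω' φ →
      testNorm Ω' φ ≤ β / C →
      -∫ x in Ω', inner ℝ ((Vsigma.field (u t) - Vsigma.field (u s) : E3 → E3) x) (φ x) ≤
        ∫ τ in s..t, R τ :=
    fun s hs t ht hst φ hφ hφr => neg_integral_inner_increment_le hΩ.isOpen hΩ' hν.le hβ0.le hT.le
      hT₁ hT₁' hucont hu'i hgi huint hbdd huineq (hpn.pos n)
      (fun x hx t ht => hN n hn _ ⟨subset_closure (hΩ' hx), hsubI ht⟩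
        (hpκ x ⟨subset_closure hx, hΩ' hx⟩ t ht)) hs ht hst hφ (hemb' φ hφ hφr).1
      (hemb' φ hφ hφr).2.1 (hemb' φ hφ hφr).2.2
  have hdual : ∀ t, ∃ F : WsigmaDual Ω', ∀ z : Wsigma Ω',
      F z = ∫ x in Ω', inner ℝ (Vsigma.field (u t) x) (z.field x) := by
    intro t
    -- Cauchy–Schwarz and the embedding into `L²(Ω)`; this crude bound only serves to show that the
    -- functional is continuous.
    refine exists_dual_of_test_bound (K := ‖v t‖ * C) (memLp_field_restrict hΩ' _) fun φ hφ => ?_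
    rw [← inner_toH_toV hΩ.isOpen hΩ' hφ, mul_assoc]
    exact (abs_real_inner_le_norm _ _).trans
      (mul_le_mul_of_nonneg_left (hemb Ω' hΩ' φ hφ).2.1 (norm_nonneg _))
  choose F hF using hdual
  have hJ0 : ∀ s ∈ Icc T₁ T₁', ∀ t ∈ Icc T₁ T₁', s ≤ t → 0 ≤ ∫ τ in s..t, R τ / (β / C) := by
    intro s hs t ht hst
    rw [intervalIntegral.integral_div]
    refine div_nonneg ?_ hr.le
    have h0 : testNorm Ω' 0 = 0 := by simpa using testNorm_smul (Ω := Ω') (φ := 0) 0 contDiff_const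
    -- The zero test field shows that the integral of `R` over any subinterval is nonnegative,
    -- although `R` itself need not be.
    simpa using hvar s hs t ht hst 0 (isSolenoidalTest_zero Ω') (h0.le.trans hr.le)
  have hvarF : eVariationOn F (Icc T₁ T₁') ≤ ENNReal.ofReal (∫ τ in T₁..T₁', R τ / (β / C)) := by
    refine eVariationOn_le_of_edist_le ((hRi.mono_set ?_).div_const _) hT₁₁' hJ0
      fun s hs t ht hst => ?_
    · rw [uIcc_of_le hT₁₁', uIcc_of_le hT.le]; exact hsubI
    · rw [edist_dist, dist_eq_norm]
      refine ENNReal.ofReal_le_ofReal (ContinuousLinearMap.opNorm_le_bound _ (hJ0 s hs t ht hst)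
        fun z => ?_)
      have hz : MemLp z.field 2 (volume.restrict Ω') :=
        (Lp.memLp z.field).mono_exponent (by norm_num)
      rw [sub_apply, hF, hF, ← integral_inner_sub (memLp_field_restrict hΩ' _)
        (memLp_field_restrict hΩ' _) hz, intervalIntegral.integral_div]
      -- Homogeneity extends the bound from the ball of radius `β / C` to all test fields, and
      -- density extends it to `W_σ(Ω')`.
      exact abs_integral_inner_le_of_test
        ((memLp_field_restrict hΩ' _).sub (memLp_field_restrict hΩ' _))
        (fun φ hφ => abs_integral_inner_le_of_ball hr (hvar s hs t ht hst) hφ) z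
  have hfinal : eVariationOn F (Icc T₁ T₁') ≤ ENNReal.ofReal
      (energyBound ν β T A (∫ t in (0 : ℝ)..T, ‖g t‖) / (β / C)) := by
    refine hvarF.trans (ENNReal.ofReal_le_ofReal ?_)
    rw [intervalIntegral.integral_div]
    gcongr
  exact ⟨F, fun t _ z => hF t z, (hfinal.trans_lt ENNReal.ofReal_lt_top).ne, hfinal⟩
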